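/- Let $M\subset\mathbb C^2$ be a domain (nonempty, open, connected), $n\ge 0$, and let $T=\sum_{j+l\le n} b_{j,l}\,d_x^j d_y^l$ be a linear partial differential operator of order $n$ whose coefficients $b_{j,l}$ are meromorphic functions on $M$. Assume that $T$ is separable: its symbol $\sum_{j+l=n} b_{j,l}X^jY^l$ is a nonzero multiple of a product of $n$ nonzero, pairwise non-proportional linear forms in $X,Y$, whose coefficients may lie in an extension of the field of meromorphic functions on $M$ (they are holomorphic functions on some nonempty connected open subset of $M$). Then there is an analytic subvariety $Z\subset M$ (closed in $M$) which is empty or of pure dimension $1$ such that for every $p=(x_0,y_0)\in M\setminus Z$ the following holds. (1) All coefficients of $T$ are holomorphic at $p$, so that $T$ acts on $P=\mathbb C[[x-x_0,y-y_0]]$, and over $P$ the symbol of $T$ factors as $c\prod_{i=1}^n(\alpha_iX+\beta_iY)$ with $c,\alpha_i,\beta_i\in P$, $c(p)\ne 0$, $(\alpha_i,\beta_i)(p)\neq(0,0)$ and $(\alpha_i\beta_j-\alpha_j\beta_i)(p)\ne 0$ for $i\ne j$. (2) For every such factorisation and every $i$, there are $f_i\in P$ with $\alpha_i\,d_xf_i+\beta_i\,d_yf_i=0$,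 $f_i(p)=0$, $(d_xf_i,d_yf_i)(p)\ne(0,0)$, and $h_{0,i},h_{1,i},\ldots\in P$ with $h_{0,i}(p)\neq 0$, such that the fractional-derivatives series $\sum_{j\ge 0}h_{j,i}\,G^{(-j)}(f_i)$ is a solution of $T=0$. Here the $G^{(s)}(f_i)$, $s\in\mathbb Z$, are free symbols, on formal sums of which the derivations $d=d_x,d_y$ act by the Leibniz rule and $d\,G^{(s)}(f_i)=(d f_i)\,G^{(s+1)}(f_i)$. (3) For every such factorisation and every fixed choice of $f_i$, $h_{j,i}$ as in (2) for $1\le i\le n$, the $\mathbb C$-vector space of all $u\in P$ with $Tu=0$ coincides with the sum $V_1+\cdots+V_n$, where $$V_i=\Big\{\sum_{l\ge 0}h_{l,i}\sum_{j\ge 0}c_j\,\frac{f_i^{\,j+l}}{(j+l)!}\ :\ (c_j)_{j\ge0}\in\mathbb C^{\mathbb N}\Big\}$$ is the space of specialisations of the $i$-th series, obtained by replacing $G^{(-l)}(f_i)$ by $\sum_{j\ge 0}c_j f_i^{j+l}/(j+l)!$. -/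

import Mathlib

open Topology Filter Finset

noncomputable section

namespace LPDO

/-- Formal power series over `ℂ` in the two local coordinates `x - x₀` (index `0`) and
`y - y₀` (index `1`). -/
abbrev PS : Type := MvPowerSeries (Fin 2) ℂ

/-! ### Meromorphic functions and analytic curves in a domain of `ℂ²` -/

/-- The germs at `q` of `g` and `h` are relatively prime: a common divisor of the two germs in the
local ring of holomorphic germs at `q` is a unit, i.e. does not vanish at `q`. -/
def CoprimeAt (g h : ℂ × ℂ → ℂ) (q : ℂ × ℂ) : Prop :=
  ∀ k g' h' : ℂ × ℂ → ℂ, AnalyticAt ℂ k q → AnalyticAt ℂ g' q → AnalyticAt ℂ h' q →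
    (∀ᶠ z in 𝓝 q, g z = k z * g' z) → (∀ᶠ z in 𝓝 q, h z = k z * h' z) → k q ≠ 0

/-- `b` is a meromorphic function on `M`: around each point of `M` it is the quotient `g / h`, in
lowest terms, of two holomorphic functions, `h` being not identically zero near any point.
The zeros of `h` are then exactly the points where `g / h` is not holomorphic (poles and points of
indeterminacy); the values of `b` at these points are irrelevant. -/
def IsMeromorphicOn (b : ℂ × ℂ → ℂ) (M : Set (ℂ × ℂ)) : Prop :=
  ∀ p ∈ M, ∃ U : Set (ℂ × ℂ), IsOpen U ∧ p ∈ U ∧ U ⊆ M ∧ ∃ g h : ℂ × ℂ → ℂ,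
    AnalyticOnNhd ℂ g U ∧ AnalyticOnNhd ℂ h U ∧
    (∀ q ∈ U, ¬ ∀ᶠ z in 𝓝 q, h z = 0) ∧
    (∀ q ∈ U, CoprimeAt g h q) ∧
    ∀ z ∈ U, h z ≠ 0 → b z = g z / h z

/-- `Z` is a (possibly empty) analytic subvariety of `M ⊆ ℂ²` of pure dimension one: around each
point of `M` (not only of `Z`, so that `Z` is closed in `M`) it is the zero set of one holomorphic
function which is not identically zero near any point. -/
def IsAnalyticCurveIn (Z M : Set (ℂ × ℂ)) : Prop :=
  Z ⊆ M ∧ ∀ p ∈ M, ∃ U : Set (ℂ × ℂ), IsOpen U ∧ p ∈ U ∧ U ⊆ M ∧ ∃ φ : ℂ × ℂ → ℂ,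
    AnalyticOnNhd ℂ φ U ∧ (∀ q ∈ U, ¬ ∀ᶠ z in 𝓝 q, φ z = 0) ∧ Z ∩ U = {z ∈ U | φ z = 0}

/-- The Taylor series at `p` of a function `b` (used only where `b` is analytic at `p`): the
coefficient at `(x - x₀) ^ r * (y - y₀) ^ s` is `(∂ₓ ^ r ∂ᵧ ^ s b)(p) / (r! s!)`. -/
def taylorAt (b : ℂ × ℂ → ℂ) (p : ℂ × ℂ) : PS := fun m =>
  iteratedDeriv (m 0) (fun x => iteratedDeriv (m 1) (fun y => b (x, y)) p.2) p.1 /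
    ((Nat.factorial (m 0) : ℂ) * (Nat.factorial (m 1) : ℂ))

/-! ### Operators `T = ∑_{j + l ≤ n} a j l dₓ ^ j dᵧ ^ l` and their symbols -/

/-- The symbol `∑_{j + l = n} a j l X ^ j Y ^ l`. -/
def symbolForm {R : Type*} [CommSemiring R] (n : ℕ) (a : ℕ → ℕ → R) (X Y : R) : R :=
  ∑ jl ∈ HasAntidiagonal.antidiagonal n, a jl.1 jl.2 * X ^ jl.1 * Y ^ jl.2

/-- The operator with coefficients `b j l` (functions on the domain `M`) is separable of order `n`:
its symbol is a nonzero multiple of a product of `n` nonzero linear forms, pairwise distinct (i.e.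
pairwise non-proportional). The coefficients of the linear forms need not lie in the field of
meromorphic functions on `M`, only in an extension of it: they are holomorphic functions on some
connected open subset `V` of `M`. -/
def IsSeparable (n : ℕ) (b : ℕ → ℕ → ℂ × ℂ → ℂ) (M : Set (ℂ × ℂ)) : Prop :=
  ∃ V : Set (ℂ × ℂ), IsOpen V ∧ IsConnected V ∧ V ⊆ M ∧
    ∃ (c : ℂ × ℂ → ℂ) (α β : Fin n → ℂ × ℂ → ℂ),
      AnalyticOnNhd ℂ c V ∧ (∀ i, AnalyticOnNhd ℂ (α i) V) ∧ (∀ i, AnalyticOnNhd ℂ (β i) V) ∧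
      (∀ z ∈ V, ∀ X Y : ℂ,
        symbolForm n (fun j l => b j l z) X Y = c z * ∏ i, (α i z * X + β i z * Y)) ∧
      (∃ z ∈ V, c z ≠ 0) ∧
      (∀ i, ∃ z ∈ V, α i z ≠ 0 ∨ β i z ≠ 0) ∧
      (∀ i j, i ≠ j → ∃ z ∈ V, α i z * β j z - α j z * β i z ≠ 0)

/-- A factorisation `c * ∏ i, (α i X + β i Y)` of the symbol of an operator with power series
coefficients, such that the values of the factors at the base point are nonzero and pairwise
non-proportional. -/
structure IsSymbolFactorization (n : ℕ) (a : ℕ → ℕ → PS) (c : PS) (α β : Fin n → PS) : Prop where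
  eq : ∀ X Y : PS, symbolForm n a X Y = c * ∏ i, (α i * X + β i * Y)
  leading_ne : MvPowerSeries.constantCoeff c ≠ 0
  factor_ne : ∀ i, MvPowerSeries.constantCoeff (α i) ≠ 0 ∨ MvPowerSeries.constantCoeff (β i) ≠ 0
  distinct : ∀ i j, i ≠ j → MvPowerSeries.constantCoeff (α i * β j - α j * β i) ≠ 0

/-- The partial derivatives `dₓ` (for `i = 0`) and `dᵧ` (for `i = 1`) of formal power series. -/
def dPS (i : Fin 2) : PS →ₗ[ℂ] PS := (MvPowerSeries.pderiv ℂ i).toLinearMap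

/-- `T = ∑_{j + l ≤ n} a j l dₓ ^ j dᵧ ^ l` acting on formal power series. -/
def applyPS (n : ℕ) (a : ℕ → ℕ → PS) : PS →ₗ[ℂ] PS :=
  ∑ p ∈ range (n + 1), ∑ jl ∈ HasAntidiagonal.antidiagonal p,
    (LinearMap.mulLeft ℂ (a jl.1 jl.2)).comp ((dPS 0 ^ jl.1).comp (dPS 1 ^ jl.2))

/-- The space of formal power series solutions of `T = 0`. -/
def solutionSpace (n : ℕ) (a : ℕ → ℕ → PS) : Submodule ℂ PS := LinearMap.ker (applyPS n a)

/-! ### Fractional-derivatives series `∑_{j ≥ 0} h j G^(-j)(f)` -/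

/-- A family `H : ℤ → PS` stands for the formal sum `∑ s, H s G^(s)(f)`. The derivation acts on it
by the rule `d G^(s) = (d f) G^(s + 1)` and the Leibniz rule. -/
def dFD (f : PS) (i : Fin 2) (H : ℤ → PS) : ℤ → PS :=
  fun s => dPS i (H s) + dPS i f * H (s - 1)

/-- `T = ∑_{j + l ≤ n} a j l dₓ ^ j dᵧ ^ l` acting on the formal sums `∑ s, H s G^(s)(f)`. -/
def applyFD (n : ℕ) (a : ℕ → ℕ → PS) (f : PS) (H : ℤ → PS) : ℤ → PS := fun s =>
  ∑ p ∈ range (n + 1), ∑ jl ∈ HasAntidiagonal.antidiagonal p,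
    a jl.1 jl.2 * ((dFD f 0)^[jl.1] ((dFD f 1)^[jl.2] H)) s

/-- The fractional-derivatives series `h 0 G^(0) + h 1 G^(-1) + h 2 G^(-2) + ⋯`. -/
def fdSeries (h : ℕ → PS) : ℤ → PS := fun s => if s ≤ 0 then h (-s).toNat else 0

/-- `∑_{j ≥ 0} h j G^(-j)(f)` is a fractional-derivatives series solution of `T = 0` belonging to
the linear factor `α X + β Y` of the symbol, normalised at the base point: `f` vanishes there, while
the gradient of `f` and the first coefficient `h 0` do not. -/
structure IsFDSolution (n : ℕ) (a : ℕ → ℕ → PS) (α β f : PS) (h : ℕ → PS) : Prop where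
  factor_eq : α * dPS 0 f + β * dPS 1 f = 0
  f_zero : MvPowerSeries.constantCoeff f = 0
  grad_ne : MvPowerSeries.constantCoeff (dPS 0 f) ≠ 0 ∨ MvPowerSeries.constantCoeff (dPS 1 f) ≠ 0
  h_ne : MvPowerSeries.constantCoeff (h 0) ≠ 0
  solves : applyFD n a f (fdSeries h) = 0

/-- The specialisation `∑_{j ≥ 0} c j f ^ (j + l) / (j + l)!` of `G^(-l)(f)`, for `f` with zero
constant term: `f ^ k` has no terms of degree less than `k`, so only `j ≤ m.degree` contribute to
the coefficient at the monomial `m`. -/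
def specG (f : PS) (c : ℕ → ℂ) (l : ℕ) : PS := fun m =>
  ∑ j ∈ range (m.degree + 1),
    c j / (Nat.factorial (j + l) : ℂ) * MvPowerSeries.coeff m (f ^ (j + l))

theorem coeff_specG (f : PS) (c : ℕ → ℂ) (l : ℕ) (m : Fin 2 →₀ ℕ) :
    MvPowerSeries.coeff m (specG f c l) = ∑ j ∈ range (m.degree + 1),
      c j / (Nat.factorial (j + l) : ℂ) * MvPowerSeries.coeff m (f ^ (j + l)) := rfl

theorem specG_add (f : PS) (c c' : ℕ → ℂ) (l : ℕ) :
    specG f (c + c') l = specG f c l + specG f c' l := by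
  ext m
  rw [map_add]
  simp only [coeff_specG, Pi.add_apply, add_div, add_mul, sum_add_distrib]

theorem specG_smul (f : PS) (r : ℂ) (c : ℕ → ℂ) (l : ℕ) :
    specG f (r • c) l = r • specG f c l := by
  ext m
  rw [map_smul]
  simp only [coeff_specG, Pi.smul_apply, smul_eq_mul, mul_sum, mul_div_assoc, mul_assoc]

/-- The specialisation of `∑_{l ≥ 0} h l G^(-l)(f)` with parameters `c`, for `f` with zero constant
term: `specG f c l` has no terms of degree less than `l`, so only `l ≤ m.degree` contribute to the
coefficient at the monomial `m`. -/
def specialisation (f : PS) (h : ℕ → PS) : (ℕ → ℂ) →ₗ[ℂ] PS where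
  toFun c := fun m => ∑ l ∈ range (m.degree + 1), MvPowerSeries.coeff m (h l * specG f c l)
  map_add' c c' := by
    funext m
    simp only [specG_add, mul_add, map_add, sum_add_distrib]
    rfl
  map_smul' r c := by
    funext m
    simp only [specG_smul, mul_smul_comm, map_smul, ← smul_sum]
    rfl

/-- The space of all specialisations of `∑_{l ≥ 0} h l G^(-l)(f)`. -/
def specialisationSpace (f : PS) (h : ℕ → PS) : Submodule ℂ PS :=
  LinearMap.range (specialisation f h)

end LPDO

end

/-!
The statement has a formal half, about power series at one point `p`, and an analytic half, which
provides the exceptional curve `Z`. Only the values at `p` of the coefficients of `T` connect the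
two: by `exists_isSymbolFactorization`, the symbol factors over the power series ring as soon as its
values at `p` form a binary form with simple zeros (Hensel's lemma, `exists_root_lift`).

*Existence of the series.* For a linear factor `α X + β Y` of the symbol, `f` is a first integral of
the vector field `α dₓ + β dᵧ`. On sums `∑ s, H s G^(s)(f)` with `s ≤ N` the operator `T` has the
leading coefficient `σ(∇f) H_N = 0` at `G^(N + n)`, and at `G^(N + n - 1)` the coefficient `L H_N`,
where `L` is a unit multiple of `α dₓ + β dᵧ` plus a term of order zero (`hasLeadingPart_applyFD`,
`symbolGrad_of_factor_eq_zero`). So `T = 0` amounts to transport equations `L h_k = ⋯` whose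
right-hand side depends on `h_0, …, h_(k - 1)` only, and these can be solved one after the other by
`exists_transport_solution`.

*Specialisations are solutions.* Replacing `G^(s)(f)` by the `s`-th derivative of a power series,
evaluated at `f`, commutes with derivations and multiplications (`IsSpecialisation.applyFD`).

*Solutions are sums of specialisations.* The lowest-degree part of a solution `u`, of degree `d`
say, is annihilated by the symbol at `p`, which is a product of pairwise independent factors
`αᵢ dₓ + βᵢ dᵧ` with constant coefficients. Hence it is a combination of the `d`-th powers of the
linear parts of the `fᵢ` (`exists_eq_sum_powers`), which are up to nonzero factors the lowest-degree
parts of the specialisations with `c_j = δ_(j d)`. Subtracting these raises the order of `u`, and the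
process converges (`IsSymbolFactorization.iSup_specialisationSpace_eq`).

*The exceptional curve.* For a suitable constant `t`, the set `Z` consists of the points where a
coefficient is not analytic or where the restriction of the symbol to the line `(x, t x + 1)` does
not have `n` distinct zeros. A meromorphic function in lowest terms is analytic exactly where its
denominator does not vanish (`analyticAt_iff_of_coprimeAt`), so that `Z` is locally the zero set of
a common denominator times a discriminant. By separability and the choice of `t` the set `Z` is not all
of `M`, and the identity principle on the connected set `M` shows that its local equations do not
vanish identically anywhere.
-/

noncomputable section

namespace LPDO

/-! ### Successive approximation and low-order coefficients -/

/-- Successive approximation: a step that improves an approximate solution `u` of level `k` to one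
of level `k + 1` without changing the entries of weight less than `k` leads to an exact solution. -/
theorem exists_forall_of_step {ι A : Type*} (wt : ι → ℕ) (Q : ℕ → (ι → A) → Prop)
    (hdep : ∀ k u v, (∀ j, wt j < k → u j = v j) → Q k u → Q k v) (h0 : ∃ u, Q 0 u)
    (hstep : ∀ k u, Q k u → ∃ v, (∀ j, wt j < k → u j = v j) ∧ Q (k + 1) v) :
    ∃ u, ∀ k, Q k u := by
  obtain ⟨u0, hu0⟩ := h0
  choose! F hF using hstep
  let s : ℕ → (ι → A) := fun k => Nat.rec u0 (fun k u => F k u) k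
  have hs : ∀ k, Q k (s k) := by
    intro k
    induction k with
    | zero => exact hu0
    | succ k ih => exact (hF k _ ih).2
  have hagree : ∀ k d j, wt j < k → s (k + d) j = s k j := by
    intro k d j hj
    induction d with
    | zero => rfl
    | succ d ih => exact ((hF (k + d) _ (hs _)).1 j (by omega)).symm.trans ih
  refine ⟨fun j => s (wt j + 1) j, fun k => hdep k (s k) _ (fun j hj => ?_) (hs k)⟩
  obtain ⟨d, rfl⟩ := Nat.exists_eq_add_of_lt hj
  have := hagree (wt j + 1) d j (by omega)
  rw [← this, show wt j + d + 1 = wt j + 1 + d by omega]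

/-- The ideal of the power series without terms of weight less than `k`. -/
def levelIdeal (w : Fin 2 → ℕ) (k : ℕ) : Ideal PS where
  carrier := {u | ∀ m, Finsupp.weight w m < k → MvPowerSeries.coeff m u = 0}
  zero_mem' := fun m _ => by simp
  add_mem' := fun {u v} hu hv m hm => by simp [hu m hm, hv m hm]
  smul_mem' := fun a u hu m hm => by
    have h1 : (k : ℕ∞) ≤ u.weightedOrder w := MvPowerSeries.nat_le_weightedOrder w hu
    refine MvPowerSeries.coeff_eq_zero_of_lt_weightedOrder w (lt_of_lt_of_le ?_
      ((h1.trans le_add_self).trans (MvPowerSeries.le_weightedOrder_mul w)))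
    exact_mod_cast hm

/-- Successive approximation in the topology of power series defined by the weights `w`. -/
theorem exists_series_of_step (w : Fin 2 → ℕ) (Q : ℕ → PS → Prop)
    (hdep : ∀ k u v, u - v ∈ levelIdeal w k → Q k u → Q k v) (h0 : ∃ u, Q 0 u)
    (hstep : ∀ k u, Q k u → ∃ v, u - v ∈ levelIdeal w k ∧ Q (k + 1) v) :
    ∃ u, ∀ k, Q k u := by
  refine exists_forall_of_step (ι := Fin 2 →₀ ℕ) (A := ℂ) (Finsupp.weight w) Q
    (fun k u v h => hdep k u v fun m hm => sub_eq_zero.2 (h m hm)) h0 fun k u hu => ?_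
  obtain ⟨v, h1, h2⟩ := hstep k u hu
  exact ⟨v, fun m hm => sub_eq_zero.1 (h1 m hm), h2⟩

theorem mul_mem_levelIdeal {w : Fin 2 → ℕ} {k l : ℕ} {u v : PS} (hu : u ∈ levelIdeal w k)
    (hv : v ∈ levelIdeal w l) : u * v ∈ levelIdeal w (k + l) := by
  intro m hm
  have h1 : (k : ℕ∞) ≤ u.weightedOrder w := MvPowerSeries.nat_le_weightedOrder w hu
  have h2 : (l : ℕ∞) ≤ v.weightedOrder w := MvPowerSeries.nat_le_weightedOrder w hv
  refine MvPowerSeries.coeff_eq_zero_of_lt_weightedOrder w (lt_of_lt_of_le ?_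
    ((add_le_add h1 h2).trans (MvPowerSeries.le_weightedOrder_mul w)))
  exact_mod_cast hm

theorem levelIdeal_mono {w : Fin 2 → ℕ} {k l : ℕ} (h : k ≤ l) :
    levelIdeal w l ≤ levelIdeal w k := fun _ hu m hm => hu m (hm.trans_le h)

/-- The ideal of the power series without terms of degree less than `k`. -/
abbrev orderIdeal (k : ℕ) : Ideal PS := levelIdeal 1 k

theorem mem_orderIdeal {k : ℕ} {u : PS} :
    u ∈ orderIdeal k ↔ ∀ m : Fin 2 →₀ ℕ, m.degree < k → MvPowerSeries.coeff m u = 0 := by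
  rw [Finsupp.degree_eq_weight_one]
  exact Iff.rfl

theorem mem_orderIdeal_zero (u : PS) : u ∈ orderIdeal 0 :=
  mem_orderIdeal.2 fun m hm => absurd hm (by omega)

theorem mem_orderIdeal_one {u : PS} :
    u ∈ orderIdeal 1 ↔ MvPowerSeries.constantCoeff u = 0 := by
  rw [mem_orderIdeal]
  constructor
  · intro h
    simpa using h 0 (by simp)
  · intro h m hm
    have : m = 0 := by
      rw [← Finsupp.degree_eq_zero_iff]
      omega
    simpa [this] using h

theorem pow_mem_orderIdeal {f : PS} (hf : MvPowerSeries.constantCoeff f = 0) (k : ℕ) :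
    f ^ k ∈ orderIdeal k := by
  induction k with
  | zero => exact mem_orderIdeal_zero _
  | succ k ih => rw [pow_succ]; exact mul_mem_levelIdeal ih (mem_orderIdeal_one.2 hf)

theorem eq_zero_of_forall_mem_orderIdeal {u : PS} (h : ∀ k, u ∈ orderIdeal k) : u = 0 := by
  ext m
  simpa using mem_orderIdeal.1 (h (m.degree + 1)) m (by omega)

/-- In lowest degree, multiplication by `a` is multiplication by the constant term of `a`. -/
theorem coeff_mul_of_mem_orderIdeal {a u : PS} {k : ℕ} (hu : u ∈ orderIdeal k) {m : Fin 2 →₀ ℕ}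
    (hm : m.degree ≤ k) :
    MvPowerSeries.coeff m (a * u) = MvPowerSeries.constantCoeff a * MvPowerSeries.coeff m u := by
  have h1 : a - MvPowerSeries.C (MvPowerSeries.constantCoeff a) ∈ orderIdeal 1 :=
    mem_orderIdeal_one.2 (by simp)
  have h2 := mem_orderIdeal.1 (mul_mem_levelIdeal h1 hu) m (by omega)
  rw [sub_mul, map_sub, sub_eq_zero] at h2
  rw [h2, MvPowerSeries.coeff_C_mul]

theorem coeff_dPS (i : Fin 2) (u : PS) (m : Fin 2 →₀ ℕ) :
    MvPowerSeries.coeff m (dPS i u) =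
      MvPowerSeries.coeff (m + Finsupp.single i 1) u * (m i + 1) :=
  MvPowerSeries.coeff_pderiv u m

theorem dPS_mul (i : Fin 2) (u v : PS) : dPS i (u * v) = u * dPS i v + dPS i u * v := by
  have := (MvPowerSeries.pderiv ℂ i).leibniz u v
  simp only [smul_eq_mul] at this
  change MvPowerSeries.pderiv ℂ i (u * v) = _
  rw [this, mul_comm v]
  rfl

theorem dPS_pow_succ (i : Fin 2) (u : PS) (k : ℕ) :
    dPS i (u ^ (k + 1)) = (k + 1 : ℂ) • (dPS i u * u ^ k) := by
  change MvPowerSeries.pderiv ℂ i (u ^ (k + 1)) = _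
  rw [Derivation.leibniz_pow, ← Nat.cast_smul_eq_nsmul ℂ, Nat.add_sub_cancel, smul_eq_mul,
    mul_comm]
  push_cast
  rfl

/-! ### Transport equations -/

/-- The antiderivative in the `i`-th variable without terms free of that variable. -/
def antideriv (i : Fin 2) : PS →ₗ[ℂ] PS where
  toFun u := fun m => MvPowerSeries.coeff (m - Finsupp.single i 1) u / (m i)
  map_add' u v := by funext m; simp only [map_add, add_div]; rfl
  map_smul' r u := by funext m; simp only [map_smul, smul_eq_mul, mul_div_assoc]; rfl

theorem coeff_antideriv (i : Fin 2) (u : PS) (m : Fin 2 →₀ ℕ) :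
    MvPowerSeries.coeff m (antideriv i u) =
      MvPowerSeries.coeff (m - Finsupp.single i 1) u / (m i) := rfl

theorem dPS_antideriv (i : Fin 2) (u : PS) : dPS i (antideriv i u) = u := by
  ext m
  rw [coeff_dPS, coeff_antideriv, add_tsub_cancel_right]
  have : (m i : ℂ) + 1 ≠ 0 := Nat.cast_add_one_ne_zero _
  simp [this]

/-- The Cauchy problem `dᵢ u = A dⱼ u + B u + G` with initial values those of `φ`. -/
theorem exists_solution_cauchy {i j : Fin 2} (hij : i ≠ j) (A B G φ : PS) (hφ : dPS i φ = 0) :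
    ∃ u : PS, dPS i u = A * dPS j u + B * u + G ∧
      ∀ m : Fin 2 →₀ ℕ, m i = 0 → MvPowerSeries.coeff m u = MvPowerSeries.coeff m φ := by
  let w : Fin 2 → ℕ := Pi.single i 1
  have hw : ∀ m : Fin 2 →₀ ℕ, Finsupp.weight w m = m i := by
    intro m
    simp [w, Finsupp.weight_apply, Finsupp.sum_fintype, Pi.single_apply]
  let R : PS → PS := fun u => φ + antideriv i (A * dPS j u + B * u + G)
  -- The right-hand side of the integrated equation gains one order in the `i`-th variable.
  have hR : ∀ k (u v : PS), u - v ∈ levelIdeal w k → R u - R v ∈ levelIdeal w (k + 1) := by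
    intro k u v huv
    have h1 : dPS j (u - v) ∈ levelIdeal w k := by
      intro m hm
      rw [coeff_dPS, huv _ ?_, zero_mul]
      rw [hw] at hm ⊢
      simpa [hij.symm] using hm
    have h2 : A * dPS j (u - v) + B * (u - v) ∈ levelIdeal w k :=
      add_mem (Ideal.mul_mem_left _ _ h1) (Ideal.mul_mem_left _ _ huv)
    have h3 : R u - R v = antideriv i (A * dPS j (u - v) + B * (u - v)) := by
      simp only [R, map_sub, map_add, mul_sub]
      ring
    rw [h3]
    intro m hm
    rw [coeff_antideriv]
    rw [hw] at hm
    rcases Nat.eq_zero_or_pos (m i) with h0 | h0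
    · simp [h0]
    · rw [h2 _ ?_, zero_div]
      rw [hw]
      simp
      omega
  obtain ⟨u, hu⟩ := exists_series_of_step w (fun k u => u - R u ∈ levelIdeal w k)
    (by
      intro k u v huv hu
      have h2 := levelIdeal_mono (Nat.le_succ k) (hR k u v huv)
      have : v - R v = (u - R u) - (u - v) + (R u - R v) := by abel
      rw [this]
      exact add_mem (sub_mem hu huv) h2)
    ⟨0, fun m hm => absurd hm (by omega)⟩
    (fun k u hu => ⟨R u, hu, hR k u (R u) hu⟩)
  have hfix : u = R u := by
    rw [← sub_eq_zero]
    ext m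
    exact hu (Finsupp.weight w m + 1) m (by omega)
  refine ⟨u, ?_, fun m hm => ?_⟩
  · conv_lhs => rw [hfix]
    simp only [R]
    rw [map_add, dPS_antideriv, hφ, zero_add]
  · conv_lhs => rw [hfix]
    simp [R, coeff_antideriv, hm]

theorem isUnit_of_constantCoeff_ne_zero {u : PS} (h : MvPowerSeries.constantCoeff u ≠ 0) :
    IsUnit u := MvPowerSeries.isUnit_iff_constantCoeff.2 (isUnit_iff_ne_zero.2 h)

/-- A non-characteristic transport equation in either of the two coordinate directions. -/
theorem exists_solution_of_isUnit {i j : Fin 2} (hij : i ≠ j) {a : PS} (ha : IsUnit a)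
    (b γ g φ : PS) (hφ : dPS i φ = 0) :
    ∃ u : PS, a * dPS i u + b * dPS j u + γ * u = g ∧
      ∀ m : Fin 2 →₀ ℕ, m i = 0 → MvPowerSeries.coeff m u = MvPowerSeries.coeff m φ := by
  obtain ⟨e, rfl⟩ := ha
  obtain ⟨u, hu, hu'⟩ := exists_solution_cauchy hij (-(↑e⁻¹ * b)) (-(↑e⁻¹ * γ)) (↑e⁻¹ * g) φ hφ
  refine ⟨u, ?_, hu'⟩
  rw [hu]
  linear_combination (-b * dPS j u - γ * u + g) * e.mul_inv

/-- A transport equation with nonvanishing vector field has a solution with value `1` at the base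
point. -/
theorem exists_transport_solution {α β : PS}
    (h : MvPowerSeries.constantCoeff α ≠ 0 ∨ MvPowerSeries.constantCoeff β ≠ 0) (γ g : PS) :
    ∃ u : PS, α * dPS 0 u + β * dPS 1 u + γ * u = g ∧ MvPowerSeries.constantCoeff u = 1 := by
  have h1 : ∀ i, dPS i 1 = 0 := fun i => MvPowerSeries.pderiv_one
  rcases h with h | h
  · obtain ⟨u, hu, hu'⟩ := exists_solution_of_isUnit (i := 0) (j := 1) (by decide)
      (isUnit_of_constantCoeff_ne_zero h) β γ g 1 (h1 0)
    exact ⟨u, hu, by simpa using hu' 0 rfl⟩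
  · obtain ⟨u, hu, hu'⟩ := exists_solution_of_isUnit (i := 1) (j := 0) (by decide)
      (isUnit_of_constantCoeff_ne_zero h) α γ g 1 (h1 1)
    exact ⟨u, by rw [← hu]; ring, by simpa using hu' 0 rfl⟩

/-- A nonvanishing vector field has a first integral which vanishes at the base point to first
order. -/
theorem exists_first_integral {α β : PS}
    (h : MvPowerSeries.constantCoeff α ≠ 0 ∨ MvPowerSeries.constantCoeff β ≠ 0) :
    ∃ f : PS, α * dPS 0 f + β * dPS 1 f = 0 ∧ MvPowerSeries.constantCoeff f = 0 ∧
      (MvPowerSeries.constantCoeff (dPS 0 f) ≠ 0 ∨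
        MvPowerSeries.constantCoeff (dPS 1 f) ≠ 0) := by
  have key : ∀ i j : Fin 2, i ≠ j → ∀ a b : PS, IsUnit a → ∃ f : PS,
      a * dPS i f + b * dPS j f = 0 ∧ MvPowerSeries.constantCoeff f = 0 ∧
        MvPowerSeries.constantCoeff (dPS j f) ≠ 0 := by
    intro i j hij a b ha
    obtain ⟨u, hu, hu'⟩ := exists_solution_of_isUnit hij ha b 0 0 (MvPowerSeries.X j)
      (MvPowerSeries.pderiv_X_of_ne hij.symm)
    refine ⟨u, by simpa using hu, by simpa using hu' 0 rfl, ?_⟩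
    rw [← MvPowerSeries.coeff_zero_eq_constantCoeff_apply, coeff_dPS,
      hu' _ (by simp [hij.symm])]
    simp [MvPowerSeries.coeff_X]
  rcases h with h | h
  · obtain ⟨f, h1, h2, h3⟩ := key 0 1 (by decide) α β (isUnit_of_constantCoeff_ne_zero h)
    exact ⟨f, h1, h2, Or.inr h3⟩
  · obtain ⟨f, h1, h2, h3⟩ := key 1 0 (by decide) β α (isUnit_of_constantCoeff_ne_zero h)
    exact ⟨f, by rw [← h1]; ring, h2, Or.inl h3⟩

/-! ### Consequences of a factorisation of the symbol -/

/-- The partial derivatives of the symbol form with respect to `X` (for `i = 0`) and `Y`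
(for `i = 1`). -/
def symbolGrad {R : Type*} [CommSemiring R] (n : ℕ) (a : ℕ → ℕ → R) (X Y : R) (i : Fin 2) : R :=
  ∑ jl ∈ HasAntidiagonal.antidiagonal n, a jl.1 jl.2 *
    ![(jl.1 : R) * X ^ (jl.1 - 1) * Y ^ jl.2, X ^ jl.1 * ((jl.2 : R) * Y ^ (jl.2 - 1))] i

/-- At a zero of the `i`-th linear factor, the directional derivative of the symbol is that of this
factor times the product of the other ones. -/
theorem symbolGrad_of_factor_eq_zero {R : Type*} [CommRing R] [IsDomain R] [Infinite R] {n : ℕ}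
    {a : ℕ → ℕ → R} {c : R} {α β : Fin n → R}
    (h : ∀ X Y : R, symbolForm n a X Y = c * ∏ i, (α i * X + β i * Y)) (i : Fin n) {x y : R}
    (hxy : α i * x + β i * y = 0) (ξ η : R) :
    ξ * symbolGrad n a x y 0 + η * symbolGrad n a x y 1 =
      (α i * ξ + β i * η) * (c * ∏ k ∈ univ.erase i, (α k * x + β k * y)) := by
  open Polynomial in
  have hpoly : ∑ jl ∈ HasAntidiagonal.antidiagonal n,
      C (a jl.1 jl.2) * (C x + C ξ * X) ^ jl.1 * (C y + C η * X) ^ jl.2 =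
      X * (C (α i * ξ + β i * η) *
        (C c * ∏ k ∈ univ.erase i, (C (α k) * (C x + C ξ * X) + C (β k) * (C y + C η * X)))) := by
    refine Polynomial.funext fun t => ?_
    have h1 := h (x + ξ * t) (y + η * t)
    rw [← mul_prod_erase univ _ (mem_univ i), symbolForm] at h1
    simp only [eval_finsetSum, eval_mul, eval_C, eval_pow, eval_add, eval_X, eval_prod]
    rw [h1]
    linear_combination (c * ∏ k ∈ univ.erase i, (α k * (x + ξ * t) + β k * (y + η * t))) * hxy
  have hd := congrArg (fun p => Polynomial.eval 0 (Polynomial.derivative p)) hpoly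
  simp only [Polynomial.derivative_mul, Polynomial.derivative_X, one_mul, zero_mul, add_zero,
    Polynomial.eval_mul, Polynomial.eval_add, Polynomial.eval_X, Polynomial.eval_C,
    Polynomial.eval_prod, mul_zero, Polynomial.derivative_sum, Polynomial.derivative_pow,
    Polynomial.derivative_C, Polynomial.derivative_add, zero_add, mul_one,
    Polynomial.eval_finsetSum, Polynomial.eval_pow] at hd
  rw [← hd, symbolGrad, symbolGrad, mul_sum, mul_sum, ← sum_add_distrib]
  refine sum_congr rfl fun jl _ => ?_
  simp
  ring

instance : IsDomain PS := NoZeroDivisors.to_isDomain _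

instance : Infinite PS :=
  Infinite.of_injective (MvPowerSeries.C : ℂ → PS) (MvPowerSeries.C_injective)

section Factorization

variable {n : ℕ} {a : ℕ → ℕ → PS} {c : PS} {α β : Fin n → PS}

theorem IsSymbolFactorization.symbolForm_eq_zero (h : IsSymbolFactorization n a c α β) (i : Fin n)
    {x y : PS} (hxy : α i * x + β i * y = 0) : symbolForm n a x y = 0 := by
  rw [h.eq, prod_eq_zero (mem_univ i) hxy, mul_zero]

/-- By pairwise independence, a nonzero vector annihilated by one linear factor is not annihilated
by any other. -/
theorem IsSymbolFactorization.constantCoeff_factor_ne (h : IsSymbolFactorization n a c α β)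
    {i k : Fin n} (hik : i ≠ k) {x y : PS} (hxy : α i * x + β i * y = 0)
    (hne : MvPowerSeries.constantCoeff x ≠ 0 ∨ MvPowerSeries.constantCoeff y ≠ 0) :
    MvPowerSeries.constantCoeff (α k * x + β k * y) ≠ 0 := by
  intro h0
  have h1 := congrArg MvPowerSeries.constantCoeff hxy
  have hd := h.distinct i k hik
  simp only [map_add, map_sub, map_mul, map_zero] at h0 h1 hd
  rcases hne with hne | hne
  · refine hd ((mul_eq_zero.1 ?_).resolve_right hne)
    linear_combination MvPowerSeries.constantCoeff (β k) * h1 -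
      MvPowerSeries.constantCoeff (β i) * h0
  · refine hd ((mul_eq_zero.1 ?_).resolve_right hne)
    linear_combination MvPowerSeries.constantCoeff (α i) * h0 -
      MvPowerSeries.constantCoeff (α k) * h1

theorem IsSymbolFactorization.constantCoeff_cofactor_ne (h : IsSymbolFactorization n a c α β)
    (i : Fin n) {x y : PS} (hxy : α i * x + β i * y = 0)
    (hne : MvPowerSeries.constantCoeff x ≠ 0 ∨ MvPowerSeries.constantCoeff y ≠ 0) :
    MvPowerSeries.constantCoeff (c * ∏ k ∈ univ.erase i, (α k * x + β k * y)) ≠ 0 := by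
  rw [map_mul, map_prod]
  exact mul_ne_zero h.leading_ne (prod_ne_zero_iff.2 fun k hk =>
    h.constantCoeff_factor_ne (ne_of_mem_erase hk).symm hxy hne)

end Factorization

/-! ### Leading parts of operators on fractional-derivatives series -/

/-- `W` acts on formal sums `∑ s, H s G^(s)` as an operator of order `p` with leading coefficient
`σ` at `G^(N + p)` and first-order transport operator `∑ i, ξ i dᵢ + e` at `G^(N + p - 1)`, where
`N` bounds the exponents occurring in `H`. -/
def HasLeadingPart (p : ℕ) (σ : PS) (ξ : Fin 2 → PS) (e : PS) (W : (ℤ → PS) → ℤ → PS) : Prop :=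
  ∀ (H : ℤ → PS) (N : ℤ), (∀ s, N < s → H s = 0) →
    (∀ s, N + p < s → W H s = 0) ∧ W H (N + p) = σ * H N ∧
    W H (N + p - 1) = σ * H (N - 1) + (∑ i, ξ i * dPS i (H N) + e * H N)

theorem HasLeadingPart.id : HasLeadingPart 0 1 0 0 id := by
  intro H N hH
  simp
  exact hH

theorem HasLeadingPart.dFD_comp {p : ℕ} {σ : PS} {ξ : Fin 2 → PS} {e : PS}
    {W : (ℤ → PS) → ℤ → PS} (h : HasLeadingPart p σ ξ e W) (f : PS) (i : Fin 2) :
    HasLeadingPart (p + 1) (dPS i f * σ) (dPS i f • ξ + Pi.single i σ) (dPS i f * e + dPS i σ)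
      (fun H => dFD f i (W H)) := by
  intro H N hH
  obtain ⟨h1, h2, h3⟩ := h H N hH
  push_cast
  refine ⟨fun s hs => ?_, ?_, ?_⟩
  · rw [dFD, h1 s (by omega), h1 (s - 1) (by omega), map_zero, mul_zero, add_zero]
  · rw [dFD, h1 _ (by omega), show N + ((p : ℤ) + 1) - 1 = N + p by ring, h2, map_zero, zero_add,
      mul_assoc]
  · rw [dFD, show N + ((p : ℤ) + 1) - 1 = N + p by ring, h2, h3, dPS_mul]
    simp only [Fin.sum_univ_two, Pi.add_apply, Pi.smul_apply, smul_eq_mul]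
    fin_cases i <;> simp <;> ring

theorem HasLeadingPart.mul_left {p : ℕ} {σ : PS} {ξ : Fin 2 → PS} {e : PS}
    {W : (ℤ → PS) → ℤ → PS} (h : HasLeadingPart p σ ξ e W) (a : PS) :
    HasLeadingPart p (a * σ) (a • ξ) (a * e) (fun H s => a * W H s) := by
  intro H N hH
  obtain ⟨h1, h2, h3⟩ := h H N hH
  refine ⟨fun s hs => ?_, ?_, ?_⟩
  · simp only [h1 s hs, mul_zero]
  · simp only [h2, mul_assoc]
  · simp only [h3, Fin.sum_univ_two, Pi.smul_apply, smul_eq_mul]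
    ring

theorem HasLeadingPart.sum {ι : Type*} (S : Finset ι) {p : ℕ} {σ : ι → PS} {ξ : ι → Fin 2 → PS}
    {e : ι → PS} {W : ι → (ℤ → PS) → ℤ → PS}
    (h : ∀ i ∈ S, HasLeadingPart p (σ i) (ξ i) (e i) (W i)) :
    HasLeadingPart p (∑ i ∈ S, σ i) (∑ i ∈ S, ξ i) (∑ i ∈ S, e i)
      (fun H s => ∑ i ∈ S, W i H s) := by
  intro H N hH
  refine ⟨fun s hs => sum_eq_zero fun i hi => (h i hi H N hH).1 s hs, ?_, ?_⟩
  · rw [sum_mul]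
    exact sum_congr rfl fun i hi => (h i hi H N hH).2.1
  · refine (sum_congr rfl fun i hi => (h i hi H N hH).2.2).trans ?_
    simp only [Fin.sum_univ_two, Finset.sum_apply, sum_mul, sum_add_distrib]

/-- An operator of smaller order contributes to the transport operator at most a term of order
zero. -/
theorem HasLeadingPart.of_lt {p q : ℕ} (hpq : p < q) {σ : PS} {ξ : Fin 2 → PS} {e : PS}
    {W : (ℤ → PS) → ℤ → PS} (h : HasLeadingPart p σ ξ e W) :
    ∃ e', HasLeadingPart q 0 0 e' W := by
  refine ⟨if p + 1 = q then σ else 0, fun H N hH => ?_⟩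
  obtain ⟨h1, h2, h3⟩ := h H N hH
  refine ⟨fun s hs => h1 s (by omega), ?_, ?_⟩
  · rw [h1 _ (by omega), zero_mul]
  · split_ifs with hq
    · subst hq
      rw [show N + ((p + 1 : ℕ) : ℤ) - 1 = N + p by push_cast; ring, h2]
      simp
    · rw [h1 _ (by omega)]
      simp

/-- The leading part of `dₓ ^ j dᵧ ^ l`: the transport operator is given by the gradient of the
monomial `X ^ j * Y ^ l` at `∇f`. -/
theorem hasLeadingPart_monomial (f : PS) (j l : ℕ) :
    ∃ e, HasLeadingPart (j + l) (dPS 0 f ^ j * dPS 1 f ^ l)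
      ![(j : PS) * dPS 0 f ^ (j - 1) * dPS 1 f ^ l,
        dPS 0 f ^ j * ((l : PS) * dPS 1 f ^ (l - 1))] e
      (fun H => (dFD f 0)^[j] ((dFD f 1)^[l] H)) := by
  have hpow : ∀ (x : PS) (k : ℕ), x * ((k : PS) * x ^ (k - 1)) + x ^ k =
      ((k + 1 : ℕ) : PS) * x ^ (k + 1 - 1) := by
    intro x k
    cases k with
    | zero => simp
    | succ k => push_cast [Nat.add_sub_cancel]; ring
  induction j with
  | zero =>
    induction l with
    | zero =>
      refine ⟨0, ?_⟩
      convert HasLeadingPart.id using 1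
      · simp
      · funext i; fin_cases i <;> simp
      · rfl
    | succ l ih =>
      obtain ⟨e, he⟩ := ih
      refine ⟨dPS 1 f * e + dPS 1 (dPS 0 f ^ 0 * dPS 1 f ^ l), ?_⟩
      convert he.dFD_comp f 1 using 1
      · omega
      · ring
      · funext i
        fin_cases i
        · simp
        · simpa using (hpow (dPS 1 f) l).symm
      · funext H
        simp only [Function.iterate_zero, id, Function.iterate_succ_apply']
  | succ j ih =>
    obtain ⟨e, he⟩ := ih
    refine ⟨dPS 0 f * e + dPS 0 (dPS 0 f ^ j * dPS 1 f ^ l), ?_⟩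
    convert he.dFD_comp f 0 using 1
    · omega
    · ring
    · funext i
      fin_cases i
      · simp only [← hpow]
        simp
        ring
      · simp
        ring
    · funext H
      simp only [Function.iterate_succ_apply']

/-- The operator `T` has the leading coefficient `F(∇f)` and the transport operator
`∇F(∇f) · (dₓ, dᵧ) + e`, where `F` is the symbol. -/
theorem hasLeadingPart_applyFD (n : ℕ) (a : ℕ → ℕ → PS) (f : PS) :
    ∃ e, HasLeadingPart n (symbolForm n a (dPS 0 f) (dPS 1 f))
      (symbolGrad n a (dPS 0 f) (dPS 1 f)) e (applyFD n a f) := by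
  choose e he using hasLeadingPart_monomial f
  have hdeg := fun p => HasLeadingPart.sum (HasAntidiagonal.antidiagonal p) (p := p)
    (fun jl hjl => by
      have := (he jl.1 jl.2).mul_left (a jl.1 jl.2)
      rw [mem_antidiagonal.1 hjl] at this
      exact this)
  have hlow : ∀ p ∈ range n, ∃ e', HasLeadingPart n 0 0 e' (fun H s =>
      ∑ jl ∈ HasAntidiagonal.antidiagonal p,
        a jl.1 jl.2 * ((dFD f 0)^[jl.1] ((dFD f 1)^[jl.2] H)) s) := by
    intro p hp
    exact (hdeg p).of_lt (mem_range.1 hp)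
  choose! e' he' using hlow
  have htop := hdeg n
  have hall := HasLeadingPart.sum (range n) he'
  refine ⟨∑ jl ∈ HasAntidiagonal.antidiagonal n, a jl.1 jl.2 * e jl.1 jl.2 +
    ∑ p ∈ range n, e' p, fun H N hH => ?_⟩
  obtain ⟨h1, h2, h3⟩ := htop H N hH
  obtain ⟨k1, k2, k3⟩ := hall H N hH
  beta_reduce at h1 h2 h3 k1 k2 k3
  simp only [applyFD, sum_range_succ]
  refine ⟨fun s hs => ?_, ?_, ?_⟩
  · rw [k1 s hs, h1 s hs, add_zero]
  · rw [k2, h2, symbolForm]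
    simp [mul_assoc]
  · rw [k3, h3]
    simp only [symbolForm, symbolGrad, mul_assoc, Fin.sum_univ_two, Finset.sum_apply,
      sum_const_zero, Pi.zero_apply, zero_mul, zero_add, Pi.smul_apply, smul_eq_mul]
    ring

theorem dFD_sub (f : PS) (i : Fin 2) (H K : ℤ → PS) :
    dFD f i (H - K) = dFD f i H - dFD f i K := by
  funext s
  simp only [dFD, Pi.sub_apply, map_sub]
  ring

theorem applyFD_sub (n : ℕ) (a : ℕ → ℕ → PS) (f : PS) (H K : ℤ → PS) :
    applyFD n a f (H - K) = applyFD n a f H - applyFD n a f K := by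
  have hit : ∀ (i : Fin 2) (k : ℕ) (H K : ℤ → PS),
      (dFD f i)^[k] (H - K) = (dFD f i)^[k] H - (dFD f i)^[k] K := by
    intro i k
    induction k with
    | zero => intro H K; rfl
    | succ k ih => intro H K; simp only [Function.iterate_succ_apply, dFD_sub, ih]
  funext s
  simp only [applyFD, hit, Pi.sub_apply, mul_sub, sum_sub_distrib]

theorem fdSeries_neg (h : ℕ → PS) (k : ℕ) : fdSeries h (-(k : ℤ)) = h k := by
  simp [fdSeries]

theorem fdSeries_of_pos (h : ℕ → PS) {s : ℤ} (hs : 0 < s) : fdSeries h s = 0 :=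
  if_neg (by omega)

theorem fdSeries_sub_eq_zero {h h' : ℕ → PS} {k : ℕ} (hh : ∀ j < k, h j = h' j) (s : ℤ)
    (hs : -(k : ℤ) < s) : (fdSeries h' - fdSeries h) s = 0 := by
  rw [Pi.sub_apply]
  rcases lt_or_ge 0 s with h0 | h0
  · rw [fdSeries_of_pos _ h0, fdSeries_of_pos _ h0, sub_zero]
  · obtain ⟨j, rfl⟩ : ∃ j : ℕ, s = -j := ⟨(-s).toNat, by omega⟩
    rw [fdSeries_neg, fdSeries_neg, hh j (by omega), sub_self]

/-- For each linear factor of the symbol there is a fractional-derivatives series solution: `f` is a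
first integral of the corresponding vector field, and the `h j` are found one after the other
from transport equations along that vector field. -/
theorem IsSymbolFactorization.exists_isFDSolution {n : ℕ} {a : ℕ → ℕ → PS} {c : PS}
    {α β : Fin n → PS} (hfac : IsSymbolFactorization n a c α β) (i : Fin n) :
    ∃ f h, IsFDSolution n a (α i) (β i) f h := by
  obtain ⟨f, hf, hf0, hfg⟩ := exists_first_integral (hfac.factor_ne i)
  obtain ⟨e, he⟩ := hasLeadingPart_applyFD n a f
  rw [hfac.symbolForm_eq_zero i hf] at he
  have hg0 := symbolGrad_of_factor_eq_zero hfac.eq i hf 1 0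
  have hg1 := symbolGrad_of_factor_eq_zero hfac.eq i hf 0 1
  have hunit := hfac.constantCoeff_cofactor_ne i hf hfg
  simp only [one_mul, zero_mul, add_zero, zero_add, mul_one, mul_zero] at hg0 hg1
  have hsolve : ∀ g : PS, ∃ v : PS,
      symbolGrad n a (dPS 0 f) (dPS 1 f) 0 * dPS 0 v +
        symbolGrad n a (dPS 0 f) (dPS 1 f) 1 * dPS 1 v + e * v = g ∧
      MvPowerSeries.constantCoeff v = 1 := by
    intro g
    refine exists_transport_solution ?_ e g
    rw [hg0, hg1, map_mul (_ : PS →+* ℂ) (α i), map_mul (_ : PS →+* ℂ) (β i)]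
    exact (hfac.factor_ne i).imp (mul_ne_zero · hunit) (mul_ne_zero · hunit)
  obtain ⟨h, hh⟩ := exists_forall_of_step (ι := ℕ) (A := PS) id
    (fun k h => (∀ j < k, MvPowerSeries.constantCoeff (h j) = 1) ∧
      ∀ s : ℤ, (n : ℤ) - k ≤ s → applyFD n a f (fdSeries h) s = 0)
    (by
      rintro k h h' hh ⟨h1, h2⟩
      refine ⟨fun j hj => by rw [← hh j hj]; exact h1 j hj, fun s hs => ?_⟩
      obtain ⟨k1, k2, -⟩ := he _ _ (fdSeries_sub_eq_zero hh)
      rw [applyFD_sub] at k1 k2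
      rw [zero_mul, Pi.sub_apply, sub_eq_zero] at k2
      rcases eq_or_lt_of_le hs with rfl | hs'
      · rw [show (n : ℤ) - k = -k + n by ring, k2]
        exact h2 _ (by omega)
      · rw [sub_eq_zero.1 (k1 s (by omega)), h2 s hs])
    (by
      refine ⟨0, fun j hj => absurd hj (by omega), fun s hs => ?_⟩
      obtain ⟨k1, k2, -⟩ := he (fdSeries 0) 0 fun s hs => fdSeries_of_pos _ hs
      rw [zero_mul, zero_add] at k2
      rcases eq_or_lt_of_le hs with rfl | hs'
      · simpa using k2
      · exact k1 s (by push_cast at hs'; omega))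
    (by
      rintro k h ⟨h1, h2⟩
      -- The new term at `G^(-k)` is chosen so as to cancel the coefficient at `G^(n - 1 - k)`.
      obtain ⟨v, hv, hv1⟩ := hsolve
        (symbolGrad n a (dPS 0 f) (dPS 1 f) 0 * dPS 0 (h k) +
          symbolGrad n a (dPS 0 f) (dPS 1 f) 1 * dPS 1 (h k) + e * h k -
          applyFD n a f (fdSeries h) (-k + n - 1))
      have hagree : ∀ j < k, h j = Function.update h k v j := fun j hj => by
        rw [Function.update_of_ne hj.ne]
      refine ⟨Function.update h k v, hagree, fun j hj => ?_, fun s hs => ?_⟩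
      · rcases Nat.lt_succ_iff_lt_or_eq.1 hj with hj' | rfl
        · rw [← hagree j hj']
          exact h1 j hj'
        · rw [Function.update_self]
          exact hv1
      · obtain ⟨k1, k2, k3⟩ := he _ _ (fdSeries_sub_eq_zero hagree)
        rw [applyFD_sub] at k1 k2 k3
        rw [zero_mul, Pi.sub_apply, sub_eq_zero] at k2
        rw [zero_mul, zero_add, Pi.sub_apply, Pi.sub_apply, fdSeries_neg, fdSeries_neg,
          Function.update_self, Fin.sum_univ_two, map_sub, map_sub] at k3
        push_cast at hs
        rcases lt_trichotomy s (-k + n) with hs' | rfl | hs'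
        · obtain rfl : s = -k + n - 1 := by omega
          linear_combination k3 + hv
        · rw [k2]
          exact h2 _ (by omega)
        · rw [sub_eq_zero.1 (k1 s hs'), h2 s (by omega)])
  refine ⟨f, h, hf, hf0, hfg, by rw [(hh 1).1 0 one_pos]; exact one_ne_zero, ?_⟩
  funext s
  exact (hh ((n : ℤ) - s).toNat).2 s (by omega)

/-! ### Specialisations are solutions -/

section Specialisation

open scoped MvPowerSeries.WithPiTopology

theorem continuous_dPS (i : Fin 2) : Continuous (dPS i) := by
  refine continuous_pi fun m => ?_
  change Continuous fun u : PS => MvPowerSeries.coeff m (dPS i u)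
  simp only [coeff_dPS]
  exact (MvPowerSeries.WithPiTopology.continuous_coeff ℂ _).mul continuous_const

variable {f : PS}

theorem hasSum_specG (hf : MvPowerSeries.constantCoeff f = 0) (c : ℕ → ℂ) (l : ℕ) :
    HasSum (fun j => (c j / (Nat.factorial (j + l) : ℂ)) • f ^ (j + l)) (specG f c l) := by
  rw [MvPowerSeries.WithPiTopology.hasSum_iff_hasSum_coeff]
  intro m
  rw [coeff_specG]
  simp only [map_smul, smul_eq_mul]
  refine hasSum_sum_of_ne_finset_zero fun j hj => ?_
  rw [mem_orderIdeal.1 (pow_mem_orderIdeal hf (j + l)) m, mul_zero]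
  rw [mem_range] at hj
  omega

theorem specG_mem_orderIdeal (hf : MvPowerSeries.constantCoeff f = 0) {c : ℕ → ℂ} {d : ℕ}
    (hc : ∀ j < d, c j = 0) (l : ℕ) : specG f c l ∈ orderIdeal (d + l) := by
  rw [mem_orderIdeal]
  intro m hm
  rw [coeff_specG]
  refine sum_eq_zero fun j _ => ?_
  by_cases hj : j < d
  · rw [hc j hj, zero_div, zero_mul]
  · rw [mem_orderIdeal.1 (pow_mem_orderIdeal hf (j + l)) m (by omega), mul_zero]

theorem dPS_smul_pow (i : Fin 2) (f : PS) (r : ℂ) (k : ℕ) :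
    dPS i ((r / (Nat.factorial (k + 1) : ℂ)) • f ^ (k + 1)) =
      dPS i f * ((r / (Nat.factorial k : ℂ)) • f ^ k) := by
  have h1 : (k : ℂ) + 1 ≠ 0 := Nat.cast_add_one_ne_zero k
  have h2 : (Nat.factorial k : ℂ) ≠ 0 := Nat.cast_ne_zero.2 (Nat.factorial_ne_zero k)
  rw [map_smul, dPS_pow_succ, smul_smul, mul_smul_comm]
  congr 1
  rw [Nat.factorial_succ]
  push_cast
  field_simp

theorem dPS_specG_succ (hf : MvPowerSeries.constantCoeff f = 0) (c : ℕ → ℂ) (l : ℕ) (i : Fin 2) :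
    dPS i (specG f c (l + 1)) = dPS i f * specG f c l := by
  have h1 := (hasSum_specG hf c (l + 1)).map (dPS i) (continuous_dPS i)
  refine h1.unique ?_
  exact ((hasSum_specG hf c l).mul_left (dPS i f)).congr_fun
    fun j => dPS_smul_pow i f (c j) (j + l)

theorem dPS_specG_zero (hf : MvPowerSeries.constantCoeff f = 0) (c : ℕ → ℂ) (i : Fin 2) :
    dPS i (specG f c 0) = dPS i f * specG f (fun j => c (j + 1)) 0 := by
  have h1 := (hasSum_specG hf c 0).map (dPS i) (continuous_dPS i)
  refine h1.unique ?_
  rw [← hasSum_nat_add_iff' 1]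
  have h2 : dPS i 1 = 0 := MvPowerSeries.pderiv_one
  have h3 : ∑ j ∈ range 1, (dPS i ∘ fun j => (c j / (Nat.factorial (j + 0) : ℂ)) • f ^ (j + 0)) j =
      0 := by
    simp [h2]
  rw [h3, sub_zero]
  exact ((hasSum_specG hf (fun j => c (j + 1)) 0).mul_left (dPS i f)).congr_fun
    fun j => dPS_smul_pow i f (c (j + 1)) j

/-- The value at `f` of the `s`-th derivative of the power series `∑ j, c j t ^ j / j!` (of the
`(-s)`-th iterated antiderivative, if `s` is negative). -/
def specZ (f : PS) (c : ℕ → ℂ) (s : ℤ) : PS := specG f (fun j => c (j + s.toNat)) (-s).toNat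

theorem dPS_specZ (hf : MvPowerSeries.constantCoeff f = 0) (c : ℕ → ℂ) (s : ℤ) (i : Fin 2) :
    dPS i (specZ f c s) = dPS i f * specZ f c (s + 1) := by
  rcases lt_or_ge s 0 with hs | hs
  · obtain ⟨l, rfl⟩ : ∃ l : ℕ, s = -(l + 1 : ℕ) := ⟨(-s - 1).toNat, by omega⟩
    have h1 : (-(-((l + 1 : ℕ) : ℤ))).toNat = l + 1 := by omega
    have h2 : (-(-((l + 1 : ℕ) : ℤ) + 1)).toNat = l := by omega
    have h3 : (-((l + 1 : ℕ) : ℤ)).toNat = 0 := by omega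
    have h4 : (-((l + 1 : ℕ) : ℤ) + 1).toNat = 0 := by omega
    rw [specZ, specZ, h1, h2, h3, h4, dPS_specG_succ hf]
  · obtain ⟨l, rfl⟩ : ∃ l : ℕ, s = l := ⟨s.toNat, by omega⟩
    have h1 : (-(l : ℤ)).toNat = 0 := by omega
    have h2 : (-((l : ℤ) + 1)).toNat = 0 := by omega
    have h3 : ((l : ℤ) + 1).toNat = l + 1 := by omega
    rw [specZ, specZ, h1, h2, h3, Int.toNat_natCast, dPS_specG_zero hf]
    simp only [add_assoc, add_comm 1 l]

theorem specZ_mem_orderIdeal (hf : MvPowerSeries.constantCoeff f = 0) (c : ℕ → ℂ) (s : ℤ) :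
    specZ f c s ∈ orderIdeal (-s).toNat := by
  have := specG_mem_orderIdeal (d := 0) hf (c := fun j => c (j + s.toNat))
    (fun j hj => absurd hj (by omega)) (-s).toNat
  rwa [zero_add] at this

theorem summable_mul_specZ (hf : MvPowerSeries.constantCoeff f = 0) (c : ℕ → ℂ) {H : ℤ → PS}
    {N : ℤ} (hH : ∀ s, N < s → H s = 0) : Summable fun s => H s * specZ f c s := by
  rw [MvPowerSeries.WithPiTopology.summable_iff_summable_coeff]
  intro m
  refine summable_of_ne_finset_zero (s := Finset.Icc (-(m.degree : ℤ)) N) fun s hs => ?_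
  rw [Finset.mem_Icc, not_and_or, not_le, not_le] at hs
  rcases hs with hs | hs
  · exact mem_orderIdeal.1 (Ideal.mul_mem_left _ (H s) (specZ_mem_orderIdeal hf c s)) m (by omega)
  · rw [hH s hs, zero_mul, map_zero]

/-- The power series `u` is the specialisation of the formal sum `∑ s, H s G^(s)(f)`, in which the
exponents `s` are bounded above. -/
def IsSpecialisation (f : PS) (c : ℕ → ℂ) (H : ℤ → PS) (u : PS) : Prop :=
  (∃ N : ℤ, ∀ s, N < s → H s = 0) ∧ HasSum (fun s => H s * specZ f c s) u

/-- Specialisation commutes with the derivations. -/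
theorem IsSpecialisation.dFD (hf : MvPowerSeries.constantCoeff f = 0) {c : ℕ → ℂ} {H : ℤ → PS}
    {u : PS} (h : IsSpecialisation f c H u) (i : Fin 2) :
    IsSpecialisation f c (dFD f i H) (dPS i u) := by
  obtain ⟨⟨N, hN⟩, h⟩ := h
  have hN' : ∀ s, N + 1 < s → dPS i f * H (s - 1) = 0 := fun s hs => by
    rw [hN _ (by omega), mul_zero]
  refine ⟨⟨N + 1, fun s hs => ?_⟩, ?_⟩
  · rw [LPDO.dFD, hN' s hs, hN s (by omega), map_zero, zero_add]
  · obtain ⟨v, hv⟩ := summable_mul_specZ hf c hN'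
    have hv' := (Equiv.addRight (1 : ℤ)).hasSum_iff.2 hv
    have h1 := h.map (dPS i) (continuous_dPS i)
    have h2 : HasSum (fun s => dPS i (H s) * specZ f c s) (dPS i u - v) := by
      refine (h1.sub hv').congr_fun fun s => ?_
      simp only [Function.comp_apply, dPS_mul, dPS_specZ hf, Equiv.coe_addRight,
        add_sub_cancel_right]
      ring
    have h3 := h2.add hv
    rw [sub_add_cancel] at h3
    refine h3.congr_fun fun s => ?_
    rw [LPDO.dFD]
    ring

theorem IsSpecialisation.mul_left {c : ℕ → ℂ} {H : ℤ → PS} {u : PS}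
    (h : IsSpecialisation f c H u) (a : PS) :
    IsSpecialisation f c (fun s => a * H s) (a * u) := by
  obtain ⟨⟨N, hN⟩, h⟩ := h
  refine ⟨⟨N, fun s hs => by simp only [hN s hs, mul_zero]⟩, ?_⟩
  exact (h.mul_left a).congr_fun fun s => mul_assoc a (H s) _

theorem isSpecialisation_sum {ι : Type*} (S : Finset ι) {c : ℕ → ℂ} {H : ι → ℤ → PS} {u : ι → PS}
    (h : ∀ i ∈ S, IsSpecialisation f c (H i) (u i)) :
    IsSpecialisation f c (fun s => ∑ i ∈ S, H i s) (∑ i ∈ S, u i) := by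
  classical
  induction S using Finset.induction_on with
  | empty => exact ⟨⟨0, fun s _ => rfl⟩, by simp⟩
  | insert i S hi ih =>
    obtain ⟨⟨N, hN⟩, h1⟩ := h i (mem_insert_self i S)
    obtain ⟨⟨N', hN'⟩, h2⟩ := ih fun j hj => h j (mem_insert_of_mem hj)
    simp only [sum_insert hi]
    refine ⟨⟨max N N', fun s hs => ?_⟩, ?_⟩
    · beta_reduce at hN' ⊢
      rw [hN s (by omega), hN' s (by omega), zero_add]
    · exact (h1.add h2).congr_fun fun s => add_mul _ _ _

/-- Specialisation commutes with the operator. -/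
theorem IsSpecialisation.applyFD (hf : MvPowerSeries.constantCoeff f = 0) {c : ℕ → ℂ} {H : ℤ → PS}
    {u : PS} (h : IsSpecialisation f c H u) (n : ℕ) (a : ℕ → ℕ → PS) :
    IsSpecialisation f c (applyFD n a f H) (applyPS n a u) := by
  have hit : ∀ (i : Fin 2) (k : ℕ) (H : ℤ → PS) (u : PS), IsSpecialisation f c H u →
      IsSpecialisation f c ((LPDO.dFD f i)^[k] H) ((dPS i ^ k) u) := by
    intro i k
    induction k with
    | zero => intro H u h; exact h
    | succ k ih =>
      intro H u h
      rw [Function.iterate_succ_apply, pow_succ]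
      exact ih _ _ (h.dFD hf i)
  simp only [applyPS, LinearMap.sum_apply, LinearMap.comp_apply, LinearMap.mulLeft_apply]
  exact isSpecialisation_sum _ fun p _ => isSpecialisation_sum _ fun jl _ =>
    (hit 0 _ _ _ (hit 1 _ _ _ h)).mul_left _

theorem hasSum_specialisation (hf : MvPowerSeries.constantCoeff f = 0) (h : ℕ → PS) (c : ℕ → ℂ) :
    HasSum (fun l => h l * specG f c l) (specialisation f h c) := by
  rw [MvPowerSeries.WithPiTopology.hasSum_iff_hasSum_coeff]
  intro m
  change HasSum _ (∑ l ∈ range (m.degree + 1), MvPowerSeries.coeff m (h l * specG f c l))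
  refine hasSum_sum_of_ne_finset_zero fun l hl => ?_
  have := specG_mem_orderIdeal (d := 0) hf (c := c) (fun j hj => absurd hj (by omega)) l
  refine mem_orderIdeal.1 (Ideal.mul_mem_left _ (h l) this) m ?_
  rw [mem_range] at hl
  omega

theorem isSpecialisation_fdSeries (hf : MvPowerSeries.constantCoeff f = 0) (h : ℕ → PS)
    (c : ℕ → ℂ) : IsSpecialisation f c (fdSeries h) (specialisation f h c) := by
  refine ⟨⟨0, fun s hs => fdSeries_of_pos h hs⟩, ?_⟩
  have hinj : Function.Injective fun l : ℕ => -(l : ℤ) := fun l l' hl => by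
    simpa using hl
  rw [← hinj.hasSum_iff]
  · refine (hasSum_specialisation hf h c).congr_fun fun l => ?_
    have h1 : (-(l : ℤ)).toNat = 0 := by omega
    simp [Function.comp_apply, fdSeries_neg, specZ, h1]
  · intro s hs
    rw [fdSeries_of_pos h, zero_mul]
    by_contra h0
    exact hs ⟨(-s).toNat, by beta_reduce; omega⟩

/-- Specialisations of a series solution are solutions. -/
theorem IsFDSolution.specialisationSpace_le {n : ℕ} {a : ℕ → ℕ → PS} {α β f : PS} {h : ℕ → PS}
    (hs : IsFDSolution n a α β f h) : specialisationSpace f h ≤ solutionSpace n a := by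
  rintro _ ⟨c, rfl⟩
  have h1 := ((isSpecialisation_fdSeries hs.f_zero h c).applyFD hs.f_zero n a).2
  rw [hs.solves] at h1
  simp only [Pi.zero_apply, zero_mul] at h1
  exact h1.unique hasSum_zero

/-- The terms of a specialisation of degree at most `d`, if the parameters `c j` vanish for
`j < d`. -/
theorem specialisation_sub_mem_orderIdeal (hf : MvPowerSeries.constantCoeff f = 0) (h : ℕ → PS)
    {c : ℕ → ℂ} {d : ℕ} (hc : ∀ j < d, c j = 0) :
    specialisation f h c - h 0 * ((c d / (Nat.factorial d : ℂ)) • f ^ d) ∈ orderIdeal (d + 1) := by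
  rw [mem_orderIdeal]
  intro m hm
  have h1 : MvPowerSeries.coeff m (specialisation f h c) =
      MvPowerSeries.coeff m (h 0 * specG f c 0) := by
    change ∑ l ∈ range (m.degree + 1), MvPowerSeries.coeff m (h l * specG f c l) = _
    refine Finset.sum_eq_single_of_mem 0 (by simp) fun l _ hl => ?_
    exact mem_orderIdeal.1 (Ideal.mul_mem_left _ (h l) (specG_mem_orderIdeal hf hc l)) m (by omega)
  have h2 : specG f c 0 - (c d / (Nat.factorial d : ℂ)) • f ^ d ∈ orderIdeal (d + 1) := by
    rw [mem_orderIdeal]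
    intro m hm
    rw [map_sub, sub_eq_zero, coeff_specG, map_smul, smul_eq_mul]
    simp only [add_zero]
    by_cases hd : m.degree = d
    · refine Finset.sum_eq_single_of_mem d (by simp [hd]) fun j hj hjd => ?_
      rw [mem_range] at hj
      rw [hc j (by omega), zero_div, zero_mul]
    · rw [mem_orderIdeal.1 (pow_mem_orderIdeal hf d) m (by omega), mul_zero]
      refine sum_eq_zero fun j hj => ?_
      rw [mem_range] at hj
      rw [hc j (by omega), zero_div, zero_mul]
  rw [map_sub, h1, ← map_sub, ← mul_sub]
  exact mem_orderIdeal.1 (Ideal.mul_mem_left _ _ h2) m hm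

end Specialisation

/-! ### Binary forms annihilated by a product of linear differential factors -/

/-- The shift of sequences. If a binary form of degree `d` is described by its derivatives
`w k = dₓ ^ k dᵧ ^ (d - k)`, the operator `α dₓ + β dᵧ` acts on it as `α * seqShift + β`. -/
def seqShift : Module.End ℂ (ℕ → ℂ) where
  toFun w := fun k => w (k + 1)
  map_add' _ _ := rfl
  map_smul' _ _ := rfl

theorem seqShift_apply (w : ℕ → ℂ) (k : ℕ) : seqShift w k = w (k + 1) := rfl

theorem seqShift_pow_apply (j : ℕ) (w : ℕ → ℂ) (k : ℕ) : (seqShift ^ j) w k = w (k + j) := by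
  induction j generalizing w with
  | zero => rfl
  | succ j ih =>
    rw [pow_succ, Module.End.mul_apply, ih, seqShift_apply, add_assoc]

open Polynomial in
theorem aeval_seqShift_linear (α β : ℂ) (w : ℕ → ℂ) (k : ℕ) :
    aeval seqShift (C α * X + C β) w k = α * w (k + 1) + β * w k := by
  simp [seqShift_apply, Algebra.algebraMap_eq_smul_one]

/-- A form annihilated by `α dₓ + β dᵧ` is a multiple of the power of one linear form. -/
theorem exists_eq_power_of_recurrence {α β ρ σ : ℂ} (h : α * ρ + β * σ = 0)
    (hαβ : α ≠ 0 ∨ β ≠ 0) (hρσ : ρ ≠ 0 ∨ σ ≠ 0) (d : ℕ) (w : ℕ → ℂ)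
    (hw : ∀ k < d, α * w (k + 1) + β * w k = 0) :
    ∃ γ, ∀ k ≤ d, w k = γ * (ρ ^ k * σ ^ (d - k)) := by
  have hrec : ∀ k < d, σ * w (k + 1) = ρ * w k := by
    intro k hk
    rcases hαβ with h0 | h0
    · refine mul_left_cancel₀ h0 ?_
      linear_combination σ * hw k hk - w k * h
    · refine mul_left_cancel₀ h0 ?_
      linear_combination -ρ * hw k hk + w (k + 1) * h
  by_cases hσ : σ = 0
  · have hρ : ρ ≠ 0 := hρσ.resolve_right (not_not.2 hσ)
    refine ⟨w d / ρ ^ d, fun k hk => ?_⟩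
    rcases hk.eq_or_lt with rfl | hk
    · field_simp
      simp
    · have h1 := hrec k hk
      rw [hσ, zero_mul] at h1
      rw [hσ, zero_pow (by omega), mul_zero, mul_zero,
        (mul_eq_zero.1 h1.symm).resolve_left hρ]
  · refine ⟨w 0 / σ ^ d, fun k hk => ?_⟩
    induction k with
    | zero => field_simp; simp
    | succ k ih =>
      refine mul_left_cancel₀ hσ ?_
      rw [hrec k (by omega), ih (by omega), show d - k = d - (k + 1) + 1 by omega]
      ring

open Polynomial in
/-- A form of degree `d` annihilated by the product of pairwise independent operators
`α i dₓ + β i dᵧ` is a combination of the `d`-th powers of linear forms annihilated by one of the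
factors; for `d < n` this says that these powers span all forms. -/
theorem exists_eq_sum_powers (n : ℕ) (α β ρ σ : Fin n → ℂ)
    (hzero : ∀ i, α i * ρ i + β i * σ i = 0) (hαβ : ∀ i, α i ≠ 0 ∨ β i ≠ 0)
    (hρσ : ∀ i, ρ i ≠ 0 ∨ σ i ≠ 0) (hne : ∀ i k, i ≠ k → α k * ρ i + β k * σ i ≠ 0) (d : ℕ)
    (w : ℕ → ℂ)
    (hw : ∀ k, k + n ≤ d → aeval seqShift (∏ i, (C (α i) * X + C (β i))) w k = 0) :
    ∃ γ : Fin n → ℂ, ∀ k ≤ d, w k = ∑ i, γ i * (ρ i ^ k * σ i ^ (d - k)) := by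
  induction n generalizing d w with
  | zero =>
    refine ⟨0, fun k hk => ?_⟩
    simpa using hw k hk
  | succ n ih =>
    rcases d with _ | d
    · refine ⟨Pi.single (Fin.last n) (w 0), fun k hk => ?_⟩
      obtain rfl : k = 0 := by omega
      simp
    · set αn := α (Fin.last n) with hαn
      set βn := β (Fin.last n) with hβn
      have hden : ∀ i : Fin n, αn * ρ i.castSucc + βn * σ i.castSucc ≠ 0 := fun i =>
        hne _ _ (Fin.castSucc_lt_last i).ne
      obtain ⟨γ, hγ⟩ := ih (fun i => α i.castSucc) (fun i => β i.castSucc)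
        (fun i => ρ i.castSucc) (fun i => σ i.castSucc) (fun i => hzero _) (fun i => hαβ _)
        (fun i => hρσ _) (fun i k hik => hne _ _ (by simpa using hik)) d
        (aeval seqShift (C αn * X + C βn) w) (fun k hk => by
          have := hw k (by omega)
          rwa [Fin.prod_univ_castSucc, map_mul, Module.End.mul_apply] at this)
      obtain ⟨γ', hγ'⟩ := exists_eq_power_of_recurrence (hzero (Fin.last n)) (hαβ _) (hρσ _) (d + 1)
        (fun k => w k - ∑ i : Fin n, γ i / (αn * ρ i.castSucc + βn * σ i.castSucc) *
          (ρ i.castSucc ^ k * σ i.castSucc ^ (d + 1 - k))) (fun k hk => by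
          have h1 := hγ k (by omega)
          rw [aeval_seqShift_linear] at h1
          rw [← hαn, ← hβn]
          have h2 : ∀ i : Fin n, γ i * (ρ i.castSucc ^ k * σ i.castSucc ^ (d - k)) =
              αn * (γ i / (αn * ρ i.castSucc + βn * σ i.castSucc) *
                (ρ i.castSucc ^ (k + 1) * σ i.castSucc ^ (d + 1 - (k + 1)))) +
              βn * (γ i / (αn * ρ i.castSucc + βn * σ i.castSucc) *
                (ρ i.castSucc ^ k * σ i.castSucc ^ (d + 1 - k))) := by
            intro i
            have h3 := hden i
            rw [show d + 1 - (k + 1) = d - k by omega, show d + 1 - k = d - k + 1 by omega]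
            field_simp
            ring
          rw [sum_congr rfl fun i _ => h2 i, sum_add_distrib, ← mul_sum, ← mul_sum] at h1
          linear_combination h1)
      refine ⟨Fin.snoc (fun i => γ i / (αn * ρ i.castSucc + βn * σ i.castSucc)) γ',
        fun k hk => ?_⟩
      rw [Fin.sum_univ_castSucc]
      simp only [Fin.snoc_castSucc, Fin.snoc_last]
      linear_combination hγ' k hk

/-! ### Solutions are sums of specialisations -/

/-- The exponent of the monomial `(x - x₀) ^ k * (y - y₀) ^ e`. -/
def expo (k e : ℕ) : Fin 2 →₀ ℕ := Finsupp.single 0 k + Finsupp.single 1 e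

theorem expo_apply_zero (k e : ℕ) : expo k e 0 = k := by simp [expo]

theorem expo_apply_one (k e : ℕ) : expo k e 1 = e := by simp [expo]

theorem degree_expo (k e : ℕ) : (expo k e).degree = k + e := by simp [expo]

theorem expo_self (m : Fin 2 →₀ ℕ) : expo (m 0) (m 1) = m := by
  ext i
  fin_cases i
  · exact expo_apply_zero _ _
  · exact expo_apply_one _ _

/-- The value `dₓ ^ k dᵧ ^ e u` at the base point. -/
def jet (k e : ℕ) : PS →ₗ[ℂ] ℂ :=
  ((Nat.factorial k : ℂ) * (Nat.factorial e : ℂ)) • MvPowerSeries.coeff (expo k e)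

theorem jet_apply (k e : ℕ) (u : PS) : jet k e u =
    (Nat.factorial k : ℂ) * (Nat.factorial e : ℂ) * MvPowerSeries.coeff (expo k e) u := rfl

theorem jet_dPS_zero (k e : ℕ) (u : PS) : jet k e (dPS 0 u) = jet (k + 1) e u := by
  have h : expo k e + Finsupp.single 0 1 = expo (k + 1) e := by
    rw [expo, expo, Finsupp.single_add]
    abel
  rw [jet_apply, jet_apply, coeff_dPS, h, expo_apply_zero, Nat.factorial_succ]
  push_cast
  ring

theorem jet_dPS_one (k e : ℕ) (u : PS) : jet k e (dPS 1 u) = jet k (e + 1) u := by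
  have h : expo k e + Finsupp.single 1 1 = expo k (e + 1) := by
    rw [expo, expo, Finsupp.single_add]
    abel
  rw [jet_apply, jet_apply, coeff_dPS, h, expo_apply_one, Nat.factorial_succ]
  push_cast
  ring

theorem jet_dPS_pow (j l k e : ℕ) (u : PS) :
    jet k e ((dPS 0 ^ j) ((dPS 1 ^ l) u)) = jet (k + j) (e + l) u := by
  have h0 : ∀ j k e (u : PS), jet k e ((dPS 0 ^ j) u) = jet (k + j) e u := by
    intro j
    induction j with
    | zero => intro k e u; rfl
    | succ j ih =>
      intro k e u
      rw [pow_succ, Module.End.mul_apply, ih, jet_dPS_zero, add_assoc]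
  have h1 : ∀ l k e (u : PS), jet k e ((dPS 1 ^ l) u) = jet k (e + l) u := by
    intro l
    induction l with
    | zero => intro k e u; rfl
    | succ l ih =>
      intro k e u
      rw [pow_succ, Module.End.mul_apply, ih, jet_dPS_one, add_assoc]
  rw [h0, h1]

theorem mem_orderIdeal_iff_jet {d : ℕ} {u : PS} :
    u ∈ orderIdeal d ↔ ∀ k e, k + e < d → jet k e u = 0 := by
  rw [mem_orderIdeal]
  constructor
  · intro h k e hke
    rw [jet_apply, h _ (by rwa [degree_expo]), mul_zero]
  · intro h m hm
    rw [← expo_self m] at hm ⊢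
    rw [degree_expo] at hm
    have h1 := h _ _ hm
    rw [jet_apply] at h1
    exact (mul_eq_zero.1 h1).resolve_left (mul_ne_zero
      (Nat.cast_ne_zero.2 (Nat.factorial_ne_zero _)) (Nat.cast_ne_zero.2 (Nat.factorial_ne_zero _)))

theorem jet_mul_of_mem_orderIdeal (a : PS) {u : PS} {d k e : ℕ} (hu : u ∈ orderIdeal d)
    (hke : k + e ≤ d) : jet k e (a * u) = MvPowerSeries.constantCoeff a * jet k e u := by
  rw [jet_apply, jet_apply, coeff_mul_of_mem_orderIdeal hu (by rwa [degree_expo])]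
  ring

/-- The lowest-degree part of `f ^ d` is the `d`-th power of the linear part of `f`. -/
theorem jet_pow {f : PS} (hf : MvPowerSeries.constantCoeff f = 0) (d : ℕ) :
    ∀ k e, k + e = d → jet k e (f ^ d) = (Nat.factorial d : ℂ) *
      (MvPowerSeries.constantCoeff (dPS 0 f) ^ k * MvPowerSeries.constantCoeff (dPS 1 f) ^ e) := by
  induction d with
  | zero =>
    intro k e h
    obtain ⟨rfl, rfl⟩ : k = 0 ∧ e = 0 := by omega
    simp [jet_apply, expo]
  | succ d ih =>
    intro k e h
    rcases k with _ | k
    · obtain ⟨e, rfl⟩ : ∃ e', e = e' + 1 := ⟨e - 1, by omega⟩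
      rw [← jet_dPS_one, dPS_pow_succ, map_smul,
        jet_mul_of_mem_orderIdeal _ (pow_mem_orderIdeal hf d) (by omega), ih 0 e (by omega),
        Nat.factorial_succ, smul_eq_mul]
      push_cast
      ring
    · rw [← jet_dPS_zero, dPS_pow_succ, map_smul,
        jet_mul_of_mem_orderIdeal _ (pow_mem_orderIdeal hf d) (by omega), ih k e (by omega),
        Nat.factorial_succ, smul_eq_mul]
      push_cast
      ring

/-- The lowest-degree part of a solution is annihilated by the symbol at the base point. -/
theorem sum_symbol_jet_eq_zero {n : ℕ} {a : ℕ → ℕ → PS} {u : PS} (hu : applyPS n a u = 0) {d : ℕ}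
    (hd : u ∈ orderIdeal d) {k : ℕ} (hk : k + n ≤ d) :
    ∑ jl ∈ HasAntidiagonal.antidiagonal n,
      MvPowerSeries.constantCoeff (a jl.1 jl.2) * jet (k + jl.1) (d - (k + jl.1)) u = 0 := by
  have h1 := congrArg (jet k (d - n - k)) hu
  rw [map_zero] at h1
  simp only [applyPS, LinearMap.sum_apply, LinearMap.comp_apply, LinearMap.mulLeft_apply,
    map_sum] at h1
  have hterm : ∀ p ∈ range (n + 1), ∀ jl ∈ HasAntidiagonal.antidiagonal p,
      jet k (d - n - k) (a jl.1 jl.2 * (dPS 0 ^ jl.1) ((dPS 1 ^ jl.2) u)) =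
        MvPowerSeries.constantCoeff (a jl.1 jl.2) * jet (k + jl.1) (d - n - k + jl.2) u := by
    intro p hp jl hjl
    rw [mem_range] at hp
    rw [HasAntidiagonal.mem_antidiagonal] at hjl
    have h2 : (dPS 0 ^ jl.1) ((dPS 1 ^ jl.2) u) ∈ orderIdeal (d - p) := by
      rw [mem_orderIdeal_iff_jet]
      intro k' e' h'
      rw [jet_dPS_pow]
      exact mem_orderIdeal_iff_jet.1 hd _ _ (by omega)
    rw [jet_mul_of_mem_orderIdeal _ h2 (by omega), jet_dPS_pow]
  rw [sum_range_succ, sum_eq_zero, zero_add] at h1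
  · rw [← h1]
    refine sum_congr rfl fun jl hjl => ?_
    rw [hterm n (by simp) jl hjl]
    rw [HasAntidiagonal.mem_antidiagonal] at hjl
    rw [show d - (k + jl.1) = d - n - k + jl.2 by omega]
  · intro p hp
    rw [mem_range] at hp
    refine sum_eq_zero fun jl hjl => ?_
    rw [hterm p (by simp; omega) jl hjl, mem_orderIdeal_iff_jet.1 hd, mul_zero]
    rw [HasAntidiagonal.mem_antidiagonal] at hjl
    omega

open Polynomial in
theorem IsSymbolFactorization.sum_C_mul_X_pow_eq {n : ℕ} {a : ℕ → ℕ → PS} {c : PS}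
    {α β : Fin n → PS} (h : IsSymbolFactorization n a c α β) :
    ∑ jl ∈ HasAntidiagonal.antidiagonal n,
        (C (MvPowerSeries.constantCoeff (a jl.1 jl.2)) * X ^ jl.1 : ℂ[X]) =
      C (MvPowerSeries.constantCoeff c) * ∏ i, (C (MvPowerSeries.constantCoeff (α i)) * X +
        C (MvPowerSeries.constantCoeff (β i))) := by
  refine Polynomial.funext fun t => ?_
  have h1 := congrArg MvPowerSeries.constantCoeff (h.eq (MvPowerSeries.C t) 1)
  simp only [symbolForm, map_sum, map_mul, map_prod, map_add, map_pow, one_pow, mul_one,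
    MvPowerSeries.constantCoeff_C] at h1
  simpa [eval_finsetSum, eval_prod] using h1

theorem specialisation_mem_orderIdeal {f : PS} (hf : MvPowerSeries.constantCoeff f = 0)
    (h : ℕ → PS) {c : ℕ → ℂ} {d : ℕ} (hc : ∀ j < d, c j = 0) :
    specialisation f h c ∈ orderIdeal d := by
  have h1 := levelIdeal_mono (Nat.le_succ d) (specialisation_sub_mem_orderIdeal hf h hc)
  refine (Submodule.sub_mem_iff_left _ ?_).1 h1
  refine Ideal.mul_mem_left _ _ ?_
  rw [MvPowerSeries.smul_eq_C_mul]
  exact Ideal.mul_mem_left _ _ (pow_mem_orderIdeal hf d)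

section

variable {n : ℕ} {a : ℕ → ℕ → PS} {c : PS} {α β : Fin n → PS} {f : Fin n → PS}
  {h : Fin n → ℕ → PS}

/-- The lowest-degree part of a solution can be removed by subtracting specialisations. -/
theorem IsSymbolFactorization.exists_sub_mem_orderIdeal (hfac : IsSymbolFactorization n a c α β)
    (hs : ∀ i, IsFDSolution n a (α i) (β i) (f i) (h i)) {u : PS} (hu : applyPS n a u = 0) {d : ℕ}
    (hd : u ∈ orderIdeal d) :
    ∃ γ : Fin n → ℂ, u - ∑ i, specialisation (f i) (h i) (Pi.single d (γ i)) ∈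
      orderIdeal (d + 1) := by
  have hzero : ∀ i, MvPowerSeries.constantCoeff (α i) * MvPowerSeries.constantCoeff (dPS 0 (f i)) +
      MvPowerSeries.constantCoeff (β i) * MvPowerSeries.constantCoeff (dPS 1 (f i)) = 0 := by
    intro i
    simpa using congrArg MvPowerSeries.constantCoeff (hs i).factor_eq
  obtain ⟨γ, hγ⟩ := exists_eq_sum_powers n _ _ _ _ hzero hfac.factor_ne
    (fun i => (hs i).grad_ne)
    (fun i k hik => by
      simpa using hfac.constantCoeff_factor_ne hik (hs i).factor_eq (hs i).grad_ne)
    d (fun k => jet k (d - k) u) (fun k hk => by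
      have h1 := sum_symbol_jet_eq_zero hu hd hk
      have h2 := congrArg (fun p => Polynomial.aeval seqShift p (fun k => jet k (d - k) u) k)
        hfac.sum_C_mul_X_pow_eq
      simp only [map_sum, map_mul, Polynomial.aeval_C, map_pow, Polynomial.aeval_X,
        LinearMap.sum_apply, Finset.sum_apply, Module.End.mul_apply,
        Module.algebraMap_end_apply, Pi.smul_apply, smul_eq_mul, seqShift_pow_apply] at h2
      rw [h1] at h2
      exact (mul_eq_zero.1 h2.symm).resolve_left hfac.leading_ne)
  refine ⟨fun i => γ i / MvPowerSeries.constantCoeff (h i 0), ?_⟩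
  have hcs : ∀ i, ∀ j < d, (Pi.single d (γ i / MvPowerSeries.constantCoeff (h i 0)) : ℕ → ℂ) j =
      0 := fun i j hj => by simp [hj.ne]
  rw [mem_orderIdeal_iff_jet]
  intro k e hke
  rw [map_sub, map_sum, sub_eq_zero]
  rcases Nat.lt_succ_iff_lt_or_eq.1 hke with hke | rfl
  · rw [mem_orderIdeal_iff_jet.1 hd _ _ hke, sum_eq_zero]
    exact fun i _ => mem_orderIdeal_iff_jet.1
      (specialisation_mem_orderIdeal (hs i).f_zero (h i) (hcs i)) _ _ hke
  · have h1 := hγ k (by omega)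
    rw [Nat.add_sub_cancel_left] at h1
    rw [h1]
    refine sum_congr rfl fun i _ => ?_
    have h2 := mem_orderIdeal_iff_jet.1
      (specialisation_sub_mem_orderIdeal (hs i).f_zero (h i) (hcs i)) k e (by omega)
    have h3 : (Nat.factorial (k + e) : ℂ) ≠ 0 := Nat.cast_ne_zero.2 (Nat.factorial_ne_zero _)
    have h4 := (hs i).h_ne
    rw [map_sub, sub_eq_zero] at h2
    rw [h2, mul_smul_comm, map_smul,
      jet_mul_of_mem_orderIdeal _ (pow_mem_orderIdeal (hs i).f_zero _) le_rfl,
      jet_pow (hs i).f_zero _ k e rfl, Pi.single_eq_same, smul_eq_mul]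
    field_simp

/-- The solution space is the sum of the spaces of specialisations. -/
theorem IsSymbolFactorization.iSup_specialisationSpace_eq (hfac : IsSymbolFactorization n a c α β)
    (hs : ∀ i, IsFDSolution n a (α i) (β i) (f i) (h i)) :
    (⨆ i, specialisationSpace (f i) (h i)) = solutionSpace n a := by
  refine le_antisymm (iSup_le fun i => (hs i).specialisationSpace_le) fun u hu => ?_
  have hspec : ∀ γ : Fin n → ℕ → ℂ, applyPS n a (∑ i, specialisation (f i) (h i) (γ i)) = 0 := by
    intro γ
    rw [map_sum]
    exact sum_eq_zero fun i _ => (hs i).specialisationSpace_le ⟨γ i, rfl⟩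
  obtain ⟨γ, hγ⟩ := exists_forall_of_step (ι := ℕ) (A := Fin n → ℂ) id
    (fun k γ => u - ∑ i, specialisation (f i) (h i) (fun j => γ j i) ∈ orderIdeal k)
    (by
      intro k γ γ' hγ hk
      have h1 : ∑ i, specialisation (f i) (h i) ((fun j => γ j i) - fun j => γ' j i) ∈
          orderIdeal k := sum_mem fun i _ =>
        specialisation_mem_orderIdeal (hs i).f_zero (h i) fun j hj => by simp [hγ j hj]
      have h2 := add_mem hk h1
      simp only [map_sub, sum_sub_distrib] at h2
      convert h2 using 1
      abel)
    ⟨0, mem_orderIdeal_zero _⟩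
    (by
      intro k γ hk
      obtain ⟨δ, hδ⟩ := hfac.exists_sub_mem_orderIdeal hs
        (u := u - ∑ i, specialisation (f i) (h i) (fun j => γ j i))
        (by rw [map_sub, hspec, sub_zero]; exact hu) hk
      refine ⟨γ + Pi.single k δ, fun j hj => ?_, ?_⟩
      · have : j ≠ k := (show j < k from hj).ne
        simp [this]
      · have h1 : ∀ i, (fun j => (γ + Pi.single k δ : ℕ → Fin n → ℂ) j i) =
            (fun j => γ j i) + Pi.single k (δ i) := by
          intro i
          funext j
          by_cases hj : j = k
          · subst hj; simp
          · simp [hj]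
        simp only [h1, map_add, sum_add_distrib]
        convert hδ using 1
        abel)
  have hu' : u = ∑ i, specialisation (f i) (h i) (fun j => γ j i) :=
    sub_eq_zero.1 (eq_zero_of_forall_mem_orderIdeal hγ)
  rw [hu']
  exact Submodule.sum_mem _ fun i _ =>
    Submodule.mem_iSup_of_mem i ⟨_, rfl⟩

end

/-! ### Binary forms with simple zeros -/

section Slice

open Polynomial

variable {R S : Type*} [CommRing R] [CommRing S]

/-- The restriction `F(x, t x + 1)` of the symbol form `F` to an affine line. -/
def slicePoly (n : ℕ) (a : ℕ → ℕ → R) (t : R) : R[X] :=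
  ∑ jl ∈ HasAntidiagonal.antidiagonal n, C (a jl.1 jl.2) * (X ^ jl.1 * (C t * X + 1) ^ jl.2)

theorem eval_slicePoly (n : ℕ) (a : ℕ → ℕ → R) (t x : R) :
    (slicePoly n a t).eval x = symbolForm n a x (t * x + 1) := by
  simp [slicePoly, symbolForm, eval_finsetSum, mul_assoc]

theorem map_slicePoly (φ : R →+* S) (n : ℕ) (a : ℕ → ℕ → R) (t : R) :
    (slicePoly n a t).map φ = slicePoly n (fun j l => φ (a j l)) (φ t) := by
  simp [slicePoly, Polynomial.map_sum]

theorem map_symbolForm (φ : R →+* S) (n : ℕ) (a : ℕ → ℕ → R) (x y : R) :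
    φ (symbolForm n a x y) = symbolForm n (fun j l => φ (a j l)) (φ x) (φ y) := by
  simp [symbolForm]

theorem symbolForm_mul_mul (n : ℕ) (a : ℕ → ℕ → R) (w x y : R) :
    symbolForm n a (w * x) (w * y) = w ^ n * symbolForm n a x y := by
  rw [symbolForm, symbolForm, mul_sum]
  refine sum_congr rfl fun jl hjl => ?_
  rw [← HasAntidiagonal.mem_antidiagonal.1 hjl]
  ring

theorem natDegree_slicePoly_le (n : ℕ) (a : ℕ → ℕ → R) (t : R) :
    (slicePoly n a t).natDegree ≤ n := by
  refine natDegree_sum_le_of_forall_le _ _ fun jl hjl => ?_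
  refine natDegree_C_mul_le _ _ |>.trans ?_
  rw [← HasAntidiagonal.mem_antidiagonal.1 hjl]
  refine natDegree_mul_le_of_le (natDegree_X_pow_le _) ?_
  refine (natDegree_pow_le_of_le jl.2 (m := 1) ?_).trans (by omega)
  compute_degree

theorem coeff_slicePoly (n : ℕ) (a : ℕ → ℕ → R) (t : R) :
    (slicePoly n a t).coeff n = symbolForm n a 1 t := by
  rw [slicePoly, finsetSum_coeff, symbolForm]
  refine sum_congr rfl fun jl hjl => ?_
  rw [coeff_C_mul, one_pow, mul_one, ← HasAntidiagonal.mem_antidiagonal.1 hjl,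
    add_comm jl.1 jl.2, coeff_X_pow_mul]
  have h1 := coeff_pow_of_natDegree_le (p := C t * X + 1) (n := 1) (m := jl.2) (by compute_degree)
  rw [mul_one] at h1
  rw [h1]
  simp [coeff_one]

/-- A factorisation of the restriction to a line, with as many factors as the degree of the form,
extends to the form. -/
theorem symbolForm_eq_of_slicePoly_eq {K : Type*} [Field K] {n : ℕ} {a : ℕ → ℕ → K} {t : K}
    {r : Fin n → K} (h : slicePoly n a t = C (symbolForm n a 1 t) * ∏ i, (X - C (r i)))
    (x y : K) :
    symbolForm n a x y = symbolForm n a 1 t * ∏ i, (x - r i * (y - t * x)) := by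
  by_cases hw : y - t * x = 0
  -- The direction `(1, t)` of the line is its point at infinity.
  · have hy : y = x * t := by linear_combination hw
    have h1 := symbolForm_mul_mul n a x 1 t
    rw [mul_one, ← hy] at h1
    rw [h1, hw]
    simp [mul_comm]
  · have h1 := congrArg (eval (x / (y - t * x))) h
    have h2 := symbolForm_mul_mul n a (y - t * x) (x / (y - t * x)) (t * (x / (y - t * x)) + 1)
    have h3 : (y - t * x) * (x / (y - t * x)) = x := by field_simp
    have h4 : (y - t * x) * (t * (x / (y - t * x)) + 1) = y := by field_simp; ring
    rw [eval_slicePoly] at h1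
    rw [h3, h4, h1] at h2
    rw [h2, eval_mul, eval_C, eval_prod, mul_left_comm]
    congr 1
    have h5 : (y - t * x) ^ n = ∏ _i : Fin n, (y - t * x) := by simp
    rw [h5, ← prod_mul_distrib]
    refine prod_congr rfl fun i _ => ?_
    rw [eval_sub, eval_X, eval_C, mul_sub, h3]
    ring

theorem symbolForm_eq_of_roots [IsDomain R] {n : ℕ} {a : ℕ → ℕ → R} {t : R} {r : Fin n → R}
    (hr : Function.Injective r) (h : ∀ i, (slicePoly n a t).eval (r i) = 0) (x y : R) :
    symbolForm n a x y = symbolForm n a 1 t * ∏ i, (x - r i * (y - t * x)) := by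
  have hpoly : slicePoly n a t = C (symbolForm n a 1 t) * ∏ i, (X - C (r i)) := by
    have hmonic : (∏ i, (X - C (r i))).Monic := monic_prod_of_monic _ _ fun i _ => monic_X_sub_C _
    have hdeg : (∏ i, (X - C (r i))).natDegree = n := by
      simp
    refine eq_of_degree_sub_lt_of_eval_index_eq univ hr.injOn ?_ fun i _ => ?_
    · rw [card_univ, Fintype.card_fin, degree_lt_iff_coeff_zero]
      intro m hm
      rcases hm.eq_or_lt with rfl | hm
      · have : (∏ i, (X - C (r i))).coeff n = 1 := by
          have h1 := hmonic.coeff_natDegree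
          rwa [hdeg] at h1
        rw [coeff_sub, coeff_C_mul, coeff_slicePoly, this, mul_one, sub_self]
      · rw [coeff_sub, coeff_C_mul,
          coeff_eq_zero_of_natDegree_lt ((natDegree_slicePoly_le n a t).trans_lt hm),
          coeff_eq_zero_of_natDegree_lt (by rwa [hdeg]), mul_zero, sub_self]
    · rw [h i, eval_mul, eval_prod, prod_eq_zero (mem_univ i) (by simp), mul_zero]
  have hinj := IsFractionRing.injective R (FractionRing R)
  have h1 := congrArg (Polynomial.map (algebraMap R (FractionRing R))) hpoly
  rw [map_slicePoly, Polynomial.map_mul, map_C, Polynomial.map_prod, map_symbolForm, map_one] at h1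
  simp only [Polynomial.map_sub, map_X, map_C] at h1
  refine hinj ?_
  rw [map_symbolForm, symbolForm_eq_of_slicePoly_eq h1]
  simp [map_symbolForm]

/-- The leading coefficient times the discriminant (up to sign) of the restriction of the form to
an affine line. -/
def discForm (n : ℕ) (t : R) (a : ℕ → ℕ → R) : R :=
  symbolForm n a 1 t * resultant (slicePoly n a t) (derivative (slicePoly n a t)) n (n - 1)

theorem separable_C_mul_iff {K : Type*} [Field K] {r : K} (hr : r ≠ 0) {p : K[X]} :
    (C r * p).Separable ↔ p.Separable :=
  (associated_unit_mul_left p (C r) (isUnit_C.2 (isUnit_iff_ne_zero.2 hr))).separable_iff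

/-- The discriminant vanishes iff the degree drops on the line or there is a multiple zero. -/
theorem discForm_ne_zero_iff {K : Type*} [Field K] [CharZero K] {n : ℕ} {t : K}
    {a : ℕ → ℕ → K} :
    discForm n t a ≠ 0 ↔ symbolForm n a 1 t ≠ 0 ∧ (slicePoly n a t).Separable := by
  rw [discForm, mul_ne_zero_iff]
  refine and_congr_right fun h => ?_
  have hdeg : (slicePoly n a t).natDegree = n :=
    natDegree_eq_of_le_of_coeff_ne_zero (natDegree_slicePoly_le n a t) (by rwa [coeff_slicePoly])
  have hne : slicePoly n a t ≠ 0 := by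
    intro h0
    rw [← coeff_slicePoly, h0, coeff_zero] at h
    exact h rfl
  have hdeg' : (derivative (slicePoly n a t)).natDegree = n - 1 := by
    rw [natDegree_derivative, hdeg]
  have hres := resultant_eq_zero_iff (f := slicePoly n a t) (g := derivative (slicePoly n a t))
  rw [hdeg, hdeg'] at hres
  rw [Ne, hres, separable_def]
  simp [hne]

theorem discForm_mul_ne_zero_iff {K : Type*} [Field K] [CharZero K] {n : ℕ} {t : K}
    {a a' : ℕ → ℕ → K} {r : K} (hr : r ≠ 0) (h : ∀ j l, j + l = n → a' j l = r * a j l) :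
    discForm n t a' ≠ 0 ↔ discForm n t a ≠ 0 := by
  have h1 : ∀ x y, symbolForm n a' x y = r * symbolForm n a x y := by
    intro x y
    rw [symbolForm, symbolForm, mul_sum]
    refine sum_congr rfl fun jl hjl => ?_
    rw [h _ _ (HasAntidiagonal.mem_antidiagonal.1 hjl)]
    ring
  have h2 : slicePoly n a' t = C r * slicePoly n a t := by
    rw [slicePoly, slicePoly, mul_sum]
    refine sum_congr rfl fun jl hjl => ?_
    rw [h _ _ (HasAntidiagonal.mem_antidiagonal.1 hjl), C_mul]
    ring
  rw [discForm_ne_zero_iff, discForm_ne_zero_iff, h1, h2, mul_ne_zero_iff,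
    separable_C_mul_iff hr]
  simp [hr]

end Slice

theorem discForm_ne_zero_of_factorization {K : Type*} [Field K] [CharZero K] {n : ℕ}
    {a : ℕ → ℕ → K} {c : K} {α β : Fin n → K}
    (h : ∀ x y, symbolForm n a x y = c * ∏ i, (α i * x + β i * y))
    (hdet : ∀ i j, i ≠ j → α i * β j - α j * β i ≠ 0) {t : K} (ht : symbolForm n a 1 t ≠ 0) :
    discForm n t a ≠ 0 := by
  open Polynomial in
  have hα : ∀ i, α i + β i * t ≠ 0 := by
    have h1 := ht
    rw [h] at h1
    intro i
    have := prod_ne_zero_iff.1 (right_ne_zero_of_mul h1) i (mem_univ i)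
    rwa [mul_one] at this
  have hinj : Function.Injective fun i => -β i / (α i + β i * t) := by
    intro i j hij
    by_contra hne
    refine hdet i j hne ?_
    rw [div_eq_div_iff (hα i) (hα j)] at hij
    linear_combination hij
  have hpoly : slicePoly n a t =
      C (symbolForm n a 1 t) * ∏ i, (X - C (-β i / (α i + β i * t))) := by
    refine Polynomial.funext fun x => ?_
    rw [eval_slicePoly, h, h, eval_mul, eval_C, eval_prod, mul_assoc, ← prod_mul_distrib]
    congr 1
    refine prod_congr rfl fun i _ => ?_
    have := hα i
    simp only [eval_sub, eval_X, eval_C]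
    field_simp
    ring
  rw [discForm_ne_zero_iff]
  refine ⟨ht, ?_⟩
  rw [hpoly, separable_C_mul_iff ht,
    separable_prod_X_sub_C_iff]
  exact hinj

/-- A nonzero product of nonzero linear forms is nonzero at some point `(1, t)`. -/
theorem exists_symbolForm_one_ne_zero {K : Type*} [Field K] [Infinite K] {n : ℕ}
    {a : ℕ → ℕ → K} {c : K} {α β : Fin n → K}
    (h : ∀ x y, symbolForm n a x y = c * ∏ i, (α i * x + β i * y)) (hc : c ≠ 0)
    (hαβ : ∀ i, α i ≠ 0 ∨ β i ≠ 0) : ∃ t, symbolForm n a 1 t ≠ 0 := by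
  open Polynomial in
  have hne : C c * ∏ i, (C (α i) + C (β i) * X) ≠ 0 := by
    refine mul_ne_zero (C_ne_zero.2 hc) (prod_ne_zero_iff.2 fun i _ h0 => ?_)
    have h1 := congrArg (fun p => coeff p 0) h0
    have h2 := congrArg (fun p => coeff p 1) h0
    simp at h1
    simp [coeff_C] at h2
    exact (hαβ i).elim (· h1) (· h2)
  by_contra! h0
  refine hne (Polynomial.funext fun t => ?_)
  have h1 := h 1 t
  rw [h0] at h1
  simpa [eval_prod] using h1.symm

theorem exists_roots_of_discForm_ne_zero {n : ℕ} {t : ℂ} {a : ℕ → ℕ → ℂ}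
    (h : discForm n t a ≠ 0) :
    ∃ r : Fin n → ℂ, Function.Injective r ∧ ∀ i, (slicePoly n a t).eval (r i) = 0 := by
  classical
  obtain ⟨h1, h2⟩ := discForm_ne_zero_iff.1 h
  have hdeg : (slicePoly n a t).natDegree = n :=
    Polynomial.natDegree_eq_of_le_of_coeff_ne_zero (natDegree_slicePoly_le n a t)
      (by rwa [coeff_slicePoly])
  have hcard : (slicePoly n a t).roots.toFinset.card = n := by
    rw [Multiset.toFinset_card_of_nodup (Polynomial.nodup_roots h2),
      ← (IsAlgClosed.splits (slicePoly n a t)).natDegree_eq_card_roots, hdeg]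
  let e := (slicePoly n a t).roots.toFinset.equivFinOfCardEq hcard
  refine ⟨fun i => (e.symm i : ℂ), fun i j hij => e.symm.injective (Subtype.ext hij), fun i => ?_⟩
  have := (e.symm i).2
  rw [Multiset.mem_toFinset] at this
  exact (Polynomial.mem_roots'.1 this).2

/-! ### Hensel's lemma for power series -/

/-- A simple root of the reduction modulo the maximal ideal lifts to a root. -/
theorem exists_root_lift (Q : Polynomial PS) (r₀ : ℂ)
    (h0 : (Q.map MvPowerSeries.constantCoeff).eval r₀ = 0)
    (h1 : (Q.map MvPowerSeries.constantCoeff).derivative.eval r₀ ≠ 0) :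
    ∃ r : PS, Q.eval r = 0 ∧ MvPowerSeries.constantCoeff r = r₀ := by
  have hmap : ∀ (P : Polynomial PS) (r : PS), MvPowerSeries.constantCoeff (P.eval r) =
      (P.map MvPowerSeries.constantCoeff).eval (MvPowerSeries.constantCoeff r) := fun P r => by
    rw [Polynomial.eval_map, Polynomial.eval₂_at_apply]
  obtain ⟨r, hr⟩ := exists_series_of_step 1
    (fun k r => Q.eval r ∈ orderIdeal k ∧ (1 ≤ k → MvPowerSeries.constantCoeff r = r₀))
    (by
      rintro k r s hrs ⟨h2, h3⟩
      refine ⟨?_, fun hk => ?_⟩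
      · rw [← Submodule.sub_mem_iff_right _ h2]
        exact Ideal.mem_of_dvd _ (Polynomial.sub_dvd_eval_sub r s Q) hrs
      · rw [← h3 hk, eq_comm, ← sub_eq_zero, ← map_sub]
        exact mem_orderIdeal_one.1 (levelIdeal_mono hk hrs))
    ⟨0, mem_orderIdeal_zero _, fun hk => absurd hk (by omega)⟩
    (by
      rintro k r ⟨h2, h3⟩
      rcases Nat.eq_zero_or_pos k with rfl | hk
      · refine ⟨MvPowerSeries.C r₀, mem_orderIdeal_zero _, ?_, fun _ =>
          MvPowerSeries.constantCoeff_C r₀⟩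
        rw [mem_orderIdeal_one, hmap, MvPowerSeries.constantCoeff_C, h0]
      · have h4 : MvPowerSeries.constantCoeff (Q.derivative.eval r) ≠ 0 := by
          rwa [hmap, h3 hk, ← Polynomial.derivative_map]
        obtain ⟨u, hu⟩ := isUnit_of_constantCoeff_ne_zero h4
        -- One step of Newton's method.
        have h5 : -(↑u⁻¹ * Q.eval r) ∈ orderIdeal k := neg_mem (Ideal.mul_mem_left _ _ h2)
        refine ⟨r + -(↑u⁻¹ * Q.eval r), ?_, ?_, fun _ => ?_⟩
        · rw [sub_add_cancel_left]
          exact neg_mem h5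
        · obtain ⟨z, hz⟩ := Q.binomExpansion r (-(↑u⁻¹ * Q.eval r))
          have h6 : Q.eval (r + -(↑u⁻¹ * Q.eval r)) = z * (-(↑u⁻¹ * Q.eval r)) ^ 2 := by
            rw [hz, ← hu]
            linear_combination -(Q.eval r) * u.mul_inv
          rw [h6, pow_two]
          exact Ideal.mul_mem_left _ _ (levelIdeal_mono (by omega) (mul_mem_levelIdeal h5 h5))
        · rw [map_add, h3 hk, mem_orderIdeal_one.1 (levelIdeal_mono hk h5), add_zero])
  exact ⟨r, eq_zero_of_forall_mem_orderIdeal fun k => (hr k).1, (hr 1).2 le_rfl⟩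

/-- If the values of the symbol coefficients at the base point form a binary form with simple
zeros, the symbol factors over the ring of power series. -/
theorem exists_isSymbolFactorization {n : ℕ} {t : ℂ} {a : ℕ → ℕ → PS}
    (h : discForm n t (fun j l => MvPowerSeries.constantCoeff (a j l)) ≠ 0) :
    ∃ c α β, IsSymbolFactorization n a c α β := by
  obtain ⟨r₀, hinj, hr₀⟩ := exists_roots_of_discForm_ne_zero h
  obtain ⟨hlead, hsep⟩ := discForm_ne_zero_iff.1 h
  have hmap : (slicePoly n a (MvPowerSeries.C t)).map MvPowerSeries.constantCoeff =
      slicePoly n (fun j l => MvPowerSeries.constantCoeff (a j l)) t := by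
    rw [map_slicePoly, MvPowerSeries.constantCoeff_C]
  have hlift : ∀ i, ∃ r : PS, (slicePoly n a (MvPowerSeries.C t)).eval r = 0 ∧
      MvPowerSeries.constantCoeff r = r₀ i := fun i => by
    refine exists_root_lift _ _ (by rw [hmap, hr₀]) ?_
    rw [hmap]
    have := hsep.eval₂_derivative_ne_zero (RingHom.id ℂ) (x := r₀ i) (hr₀ i)
    exact this
  choose r hr hr' using hlift
  have hrinj : Function.Injective r := fun i j hij => hinj (by rw [← hr', ← hr', hij])
  refine ⟨symbolForm n a 1 (MvPowerSeries.C t), fun i => 1 + MvPowerSeries.C t * r i, fun i => -r i,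
    ⟨fun x y => ?_, ?_, fun i => ?_, fun i j hij => ?_⟩⟩
  · rw [symbolForm_eq_of_roots hrinj hr]
    congr 1
    exact prod_congr rfl fun i _ => by ring
  · rwa [map_symbolForm, map_one, MvPowerSeries.constantCoeff_C]
  · by_cases h0 : r₀ i = 0
    · left
      simp [hr', h0]
    · right
      simpa [hr'] using h0
  · have h1 : (1 + MvPowerSeries.C t * r i) * -r j - (1 + MvPowerSeries.C t * r j) * -r i =
        r i - r j := by ring
    rw [h1, map_sub, hr', hr', sub_ne_zero]
    exact fun h => hij (hinj h)

/-! ### Analyticity of the discriminant -/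

section Analytic

variable {E : Type*} [NormedAddCommGroup E] [NormedSpace ℂ E]

theorem analyticAt_coeff_slicePoly {n : ℕ} (t : ℂ) {A : ℕ → ℕ → E → ℂ} {z : E}
    (hA : ∀ j l, j + l = n → AnalyticAt ℂ (A j l) z) (k : ℕ) :
    AnalyticAt ℂ (fun z => (slicePoly n (fun j l => A j l z) t).coeff k) z := by
  simp only [slicePoly, Polynomial.finsetSum_coeff, Polynomial.coeff_C_mul]
  exact Finset.analyticAt_fun_sum _ fun jl hjl =>
    (hA _ _ (HasAntidiagonal.mem_antidiagonal.1 hjl)).mul analyticAt_const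

theorem analyticAt_resultant {P Q : E → Polynomial ℂ} {z : E}
    (hP : ∀ k, AnalyticAt ℂ (fun z => (P z).coeff k) z)
    (hQ : ∀ k, AnalyticAt ℂ (fun z => (Q z).coeff k) z) (m n : ℕ) :
    AnalyticAt ℂ (fun z => Polynomial.resultant (P z) (Q z) m n) z := by
  simp only [Polynomial.resultant, Matrix.det_apply']
  refine Finset.analyticAt_fun_sum _ fun τ _ => analyticAt_const.mul
    (Finset.analyticAt_fun_prod _ fun i _ => ?_)
  simp only [Polynomial.sylvester, Matrix.of_apply]
  induction i using Fin.addCases with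
  | left i =>
    simp only [Fin.addCases_left]
    split_ifs
    · exact hQ _
    · exact analyticAt_const
  | right i =>
    simp only [Fin.addCases_right]
    split_ifs
    · exact hP _
    · exact analyticAt_const

theorem analyticAt_discForm {n : ℕ} (t : ℂ) {A : ℕ → ℕ → E → ℂ} {z : E}
    (hA : ∀ j l, j + l = n → AnalyticAt ℂ (A j l) z) :
    AnalyticAt ℂ (fun z => discForm n t (fun j l => A j l z)) z := by
  have h1 := analyticAt_coeff_slicePoly t hA
  simp only [discForm, ← coeff_slicePoly]
  refine (h1 n).mul (analyticAt_resultant h1 (fun k => ?_) _ _)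
  simp only [Polynomial.coeff_derivative]
  exact (h1 _).mul analyticAt_const

end Analytic

/-! ### Generic points and the identity principle -/

section Generic

variable {X : Type*} [TopologicalSpace X]

/-- The property `P` holds on a dense open subset of `V`. -/
def HoldsGenerically (V : Set X) (P : X → Prop) : Prop :=
  ∀ W : Set X, IsOpen W → W.Nonempty → W ⊆ V →
    ∃ W' : Set X, IsOpen W' ∧ W'.Nonempty ∧ W' ⊆ W ∧ ∀ z ∈ W', P z

theorem HoldsGenerically.and {V : Set X} {P Q : X → Prop} (hP : HoldsGenerically V P)
    (hQ : HoldsGenerically V Q) : HoldsGenerically V (fun z => P z ∧ Q z) := by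
  intro W hW hne hWV
  obtain ⟨W', h1, h2, h3, h4⟩ := hP W hW hne hWV
  obtain ⟨W'', k1, k2, k3, k4⟩ := hQ W' h1 h2 (h3.trans hWV)
  exact ⟨W'', k1, k2, k3.trans h3, fun z hz => ⟨h4 z (k3 hz), k4 z hz⟩⟩

theorem holdsGenerically_forall_mem {ι : Type*} (S : Finset ι) {V : Set X} {P : ι → X → Prop}
    (h : ∀ i ∈ S, HoldsGenerically V (P i)) : HoldsGenerically V (fun z => ∀ i ∈ S, P i z) := by
  classical
  induction S using Finset.induction_on with
  | empty => exact fun W hW hne _ => ⟨W, hW, hne, subset_rfl, by simp⟩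
  | insert i S _ ih =>
    intro W hW hne hWV
    obtain ⟨W', h1, h2, h3, h4⟩ := (h i (mem_insert_self i S)).and
      (ih fun j hj => h j (mem_insert_of_mem hj)) W hW hne hWV
    refine ⟨W', h1, h2, h3, fun z hz j hj => ?_⟩
    rcases mem_insert.1 hj with rfl | hj
    · exact (h4 z hz).1
    · exact (h4 z hz).2 j hj

end Generic

section Identity

variable {E : Type*} [NormedAddCommGroup E] [NormedSpace ℂ E]

theorem holdsGenerically_ne_zero {V : Set E} (hV : IsPreconnected V) {φ : E → ℂ}
    (hφ : AnalyticOnNhd ℂ φ V) (hne : ∃ z ∈ V, φ z ≠ 0) :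
    HoldsGenerically V (fun z => φ z ≠ 0) := by
  intro W hW hWne hWV
  obtain ⟨z, hz, hz0⟩ := hne
  have h1 : ∃ q ∈ W, φ q ≠ 0 := by
    by_contra! h0
    obtain ⟨q, hq⟩ := hWne
    exact hz0 (hφ.eqOn_zero_of_preconnected_of_eventuallyEq_zero hV (hWV hq)
      (Filter.eventually_of_mem (hW.mem_nhds hq) h0) hz)
  refine ⟨W ∩ φ ⁻¹' {0}ᶜ, ?_, h1, Set.inter_subset_left, fun z hz => hz.2⟩
  exact (hφ.continuousOn.mono hWV).isOpen_inter_preimage hW isOpen_compl_singleton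

/-- The identity principle for a set which is locally, in `M`, the zero set of an analytic
function. -/
theorem not_eventually_mem_of_isPreconnected {Z M : Set E} (hM : IsPreconnected M)
    (hloc : ∀ p ∈ M, ∃ U : Set E, IsOpen U ∧ p ∈ U ∧ IsPreconnected U ∧ ∃ φ : E → ℂ,
      AnalyticOnNhd ℂ φ U ∧ ∀ z ∈ U, z ∈ Z ↔ φ z = 0)
    (hne : ∃ q ∈ M, q ∉ Z) : ∀ q ∈ M, ¬ ∀ᶠ z in 𝓝 q, z ∈ Z := by
  intro q hq hqZ
  obtain ⟨q₀, hq₀, hq₀Z⟩ := hne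
  let u : Set E := {z | ∀ᶠ z' in 𝓝 z, z' ∈ Z}
  let v : Set E := {z | ∀ᶠ z' in 𝓝 z, z' ∉ u}
  have hu : IsOpen u := isOpen_iff_mem_nhds.2 fun z hz => eventually_eventually_nhds.2 hz
  have hv : IsOpen v := isOpen_iff_mem_nhds.2 fun z hz => eventually_eventually_nhds.2 hz
  have hnotmem : ∀ z ∈ M, z ∉ u → z ∈ v := by
    intro z hz hzu
    obtain ⟨U, hU, hzU, hUc, φ, hφ, hUZ⟩ := hloc z hz
    refine Filter.eventually_of_mem (hU.mem_nhds hzU) fun z' hz' hz'u => hzu ?_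
    have h0 : φ =ᶠ[𝓝 z'] 0 := by
      filter_upwards [hz'u, hU.mem_nhds hz'] with w hw hwU
      exact (hUZ w hwU).1 hw
    have h1 := hφ.eqOn_zero_of_preconnected_of_eventuallyEq_zero hUc hz' h0
    exact Filter.eventually_of_mem (hU.mem_nhds hzU) fun w hw => (hUZ w hw).2 (h1 hw)
  have hq₀u : q₀ ∉ u := fun h => hq₀Z h.self_of_nhds
  obtain ⟨z, -, hzu, hzv⟩ := hM u v hu hv (fun z hz => by
    by_cases h : z ∈ u
    · exact Or.inl h
    · exact Or.inr (hnotmem z hz h)) ⟨q, hq, hqZ⟩ ⟨q₀, hq₀, hnotmem q₀ hq₀ hq₀u⟩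
  exact hzv.self_of_nhds hzu

end Identity

/-! ### Meromorphic coefficients -/

/-- A quotient in lowest terms is analytic exactly where the denominator does not vanish. -/
theorem analyticAt_iff_of_coprimeAt {U : Set (ℂ × ℂ)} (hU : IsOpen U) {b g h : ℂ × ℂ → ℂ}
    (hg : AnalyticOnNhd ℂ g U) (hh : AnalyticOnNhd ℂ h U)
    (hne : ∀ q ∈ U, ¬ ∀ᶠ z in 𝓝 q, h z = 0) (hcop : ∀ q ∈ U, CoprimeAt g h q)
    (hb : ∀ z ∈ U, h z ≠ 0 → b z = g z / h z) {q : ℂ × ℂ} (hq : q ∈ U) :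
    AnalyticAt ℂ b q ↔ h q ≠ 0 := by
  constructor
  · intro hbq
    refine hcop q hq h b 1 (hh q hq) hbq analyticAt_const ?_ (by simp)
    have hana : AnalyticAt ℂ (fun z => g z - h z * b z) q := (hg q hq).sub ((hh q hq).mul hbq)
    obtain ⟨r, hr, hball⟩ := Metric.eventually_nhds_iff_ball.1
      (hana.eventually_analyticAt.and (hU.mem_nhds hq))
    have hball' : AnalyticOnNhd ℂ (fun z => g z - h z * b z) (Metric.ball q r) :=
      fun z hz => (hball z hz).1
    have hpre : IsPreconnected (Metric.ball q r) := (convex_ball q r).isPreconnected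
    -- The function `g - h b` vanishes wherever `h` does not, hence on a nonempty open set.
    obtain ⟨w, hw, hw0⟩ : ∃ w ∈ Metric.ball q r, h w ≠ 0 := by
      by_contra! h0
      exact hne q hq (Filter.eventually_of_mem (Metric.ball_mem_nhds q hr) h0)
    have hzero : (fun z => g z - h z * b z) =ᶠ[𝓝 w] 0 := by
      have hwU := (hball w hw).2
      filter_upwards [(hh w hwU).continuousAt.eventually_ne hw0, hU.mem_nhds hwU] with z hz hzU
      rw [hb z hzU hz]
      simp only [Pi.zero_apply]
      field_simp
      simp
    have heq := hball'.eqOn_zero_of_preconnected_of_eventuallyEq_zero hpre hw hzero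
    exact Filter.eventually_of_mem (Metric.ball_mem_nhds q hr) fun z hz => sub_eq_zero.1 (heq hz)
  · intro hq0
    refine ((hg q hq).div (hh q hq) hq0).congr ?_
    filter_upwards [(hh q hq).continuousAt.eventually_ne hq0, hU.mem_nhds hq] with z hz hzU
    exact (hb z hzU hz).symm

theorem IsMeromorphicOn.holdsGenerically_analyticAt {b : ℂ × ℂ → ℂ} {M : Set (ℂ × ℂ)}
    (hb : IsMeromorphicOn b M) : HoldsGenerically M (fun z => AnalyticAt ℂ b z) := by
  intro W hW ⟨p, hp⟩ hWM
  obtain ⟨U, hU, hpU, -, g, h, hg, hh, hne, hcop, hbU⟩ := hb p (hWM hp)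
  have hWU : IsOpen (W ∩ U) := hW.inter hU
  refine ⟨(W ∩ U) ∩ h ⁻¹' {0}ᶜ, ?_, ?_, fun z hz => hz.1.1, fun z hz => ?_⟩
  · exact (hh.continuousOn.mono Set.inter_subset_right).isOpen_inter_preimage hWU
      isOpen_compl_singleton
  · by_contra h0
    rw [Set.not_nonempty_iff_eq_empty, Set.eq_empty_iff_forall_notMem] at h0
    refine hne p hpU (Filter.eventually_of_mem (hWU.mem_nhds ⟨hp, hpU⟩) fun z hz => ?_)
    by_contra hz0
    exact h0 z ⟨hz, hz0⟩
  · exact (analyticAt_iff_of_coprimeAt hU hg hh hne hcop hbU hz.1.2).2 hz.2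

/-- The index set of the coefficients of an operator of order `n`. -/
def coeffIndex (n : ℕ) : Finset (ℕ × ℕ) :=
  (range (n + 1) ×ˢ range (n + 1)).filter fun jl => jl.1 + jl.2 ≤ n

theorem mem_coeffIndex {n : ℕ} {jl : ℕ × ℕ} : jl ∈ coeffIndex n ↔ jl.1 + jl.2 ≤ n := by
  simp only [coeffIndex, mem_filter, mem_product, mem_range]
  omega

/-- The points of `M` where a coefficient is not analytic or where the restriction of the symbol to
the line `(x, t x + 1)` drops degree or has a multiple zero. -/
def singularLocus (n : ℕ) (b : ℕ → ℕ → ℂ × ℂ → ℂ) (M : Set (ℂ × ℂ)) (t : ℂ) : Set (ℂ × ℂ) :=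
  {z ∈ M | (∃ j l, j + l ≤ n ∧ ¬ AnalyticAt ℂ (b j l) z) ∨ discForm n t (fun j l => b j l z) = 0}

/-- A local equation of the singular locus. Multiplying all coefficients by a common denominator `H`
does not affect the zeros of the discriminant outside those of `H`, and the latter are the points
where some coefficient is not analytic. -/
theorem exists_local_equation_singularLocus {n : ℕ} {b : ℕ → ℕ → ℂ × ℂ → ℂ} {M : Set (ℂ × ℂ)}
    (hM : IsOpen M) (hb : ∀ j l, j + l ≤ n → IsMeromorphicOn (b j l) M) (t : ℂ) {p : ℂ × ℂ}
    (hp : p ∈ M) :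
    ∃ U : Set (ℂ × ℂ), IsOpen U ∧ p ∈ U ∧ U ⊆ M ∧ IsPreconnected U ∧ ∃ φ : ℂ × ℂ → ℂ,
      AnalyticOnNhd ℂ φ U ∧ ∀ z ∈ U, z ∈ singularLocus n b M t ↔ φ z = 0 := by
  have hchart : ∀ jl ∈ coeffIndex n, ∃ U : Set (ℂ × ℂ), IsOpen U ∧ p ∈ U ∧
      ∃ g h : ℂ × ℂ → ℂ, AnalyticOnNhd ℂ g U ∧ AnalyticOnNhd ℂ h U ∧
        (∀ z ∈ U, AnalyticAt ℂ (b jl.1 jl.2) z ↔ h z ≠ 0) ∧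
        ∀ z ∈ U, h z ≠ 0 → b jl.1 jl.2 z = g z / h z := by
    intro jl hjl
    obtain ⟨U, hU, hpU, -, g, h, hg, hh, hne, hcop, hbU⟩ := hb _ _ (mem_coeffIndex.1 hjl) p hp
    exact ⟨U, hU, hpU, g, h, hg, hh,
      fun z hz => analyticAt_iff_of_coprimeAt hU hg hh hne hcop hbU hz, hbU⟩
  choose! U hU hpU g h hg hh hana hbU using hchart
  obtain ⟨r, hr, hball⟩ := Metric.eventually_nhds_iff_ball.1
    (((Filter.eventually_all_finset (coeffIndex n)).2 fun jl hjl =>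
      (hU jl hjl).mem_nhds (hpU jl hjl)).and (hM.mem_nhds hp))
  have hsub : ∀ jl ∈ coeffIndex n, ∀ z ∈ Metric.ball p r, z ∈ U jl :=
    fun jl hjl z hz => (hball z hz).1 jl hjl
  -- `H` is a common denominator, and `A j l` is the numerator of `b j l` with this denominator.
  let H : ℂ × ℂ → ℂ := fun z => ∏ jl ∈ coeffIndex n, h jl z
  let A : ℕ → ℕ → ℂ × ℂ → ℂ := fun j l z =>
    g (j, l) z * ∏ kl ∈ (coeffIndex n).erase (j, l), h kl z
  have hH : ∀ z ∈ Metric.ball p r, AnalyticAt ℂ H z := fun z hz =>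
    Finset.analyticAt_fun_prod _ fun jl hjl => hh jl hjl z (hsub jl hjl z hz)
  have hA : ∀ z ∈ Metric.ball p r, ∀ j l, j + l = n → AnalyticAt ℂ (A j l) z := by
    intro z hz j l hjl
    have hmem : (j, l) ∈ coeffIndex n := mem_coeffIndex.2 hjl.le
    refine (hg _ hmem z (hsub _ hmem z hz)).mul (Finset.analyticAt_fun_prod _ fun kl hkl => ?_)
    have hkl' := mem_of_mem_erase hkl
    exact hh kl hkl' z (hsub kl hkl' z hz)
  refine ⟨Metric.ball p r, Metric.isOpen_ball, Metric.mem_ball_self hr,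
    fun z hz => (hball z hz).2, (convex_ball p r).isPreconnected,
    fun z => H z * discForm n t (fun j l => A j l z),
    fun z hz => (hH z hz).mul (analyticAt_discForm t (hA z hz)), fun z hz => ?_⟩
  have hpole : (∃ j l, j + l ≤ n ∧ ¬ AnalyticAt ℂ (b j l) z) ↔ H z = 0 := by
    rw [prod_eq_zero_iff]
    constructor
    · rintro ⟨j, l, hjl, hn⟩
      have hmem : (j, l) ∈ coeffIndex n := mem_coeffIndex.2 hjl
      refine ⟨(j, l), hmem, ?_⟩
      by_contra h0
      exact hn ((hana _ hmem z (hsub _ hmem z hz)).2 h0)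
    · rintro ⟨jl, hjl, h0⟩
      exact ⟨jl.1, jl.2, mem_coeffIndex.1 hjl,
        fun h1 => (hana jl hjl z (hsub jl hjl z hz)).1 h1 h0⟩
  rw [singularLocus, Set.mem_ofPred_eq, hpole, mul_eq_zero,
    and_iff_right (show z ∈ M from (hball z hz).2)]
  by_cases h0 : H z = 0
  · simp [h0]
  · rw [or_iff_right h0, or_iff_right h0]
    refine not_iff_not.1 (discForm_mul_ne_zero_iff h0 fun j l hjl => ?_).symm
    have hmem : (j, l) ∈ coeffIndex n := mem_coeffIndex.2 hjl.le
    have h1 : h (j, l) z ≠ 0 := prod_ne_zero_iff.1 h0 _ hmem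
    have h2 : H z = h (j, l) z * ∏ kl ∈ (coeffIndex n).erase (j, l), h kl z :=
      (mul_prod_erase _ _ hmem).symm
    rw [h2, hbU _ hmem z (hsub _ hmem z hz) h1]
    simp only [A]
    field_simp

/-- Separability at the generic point gives one line on which the symbol has simple zeros at some
point of `M`. -/
theorem IsSeparable.exists_notMem_singularLocus {n : ℕ} {b : ℕ → ℕ → ℂ × ℂ → ℂ}
    {M : Set (ℂ × ℂ)} (hsep : IsSeparable n b M)
    (hb : ∀ j l, j + l ≤ n → IsMeromorphicOn (b j l) M) :
    ∃ t, ∃ q ∈ M, q ∉ singularLocus n b M t := by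
  obtain ⟨V, hV, hVc, hVM, c, α, β, hc, hα, hβ, heq, hc0, hαβ, hdet⟩ := hsep
  have g1 := holdsGenerically_ne_zero hVc.isPreconnected hc hc0
  have g2 : HoldsGenerically V fun z => ∀ i ∈ univ, α i z ≠ 0 ∨ β i z ≠ 0 := by
    refine holdsGenerically_forall_mem univ fun i _ W hW hne hWV => ?_
    obtain ⟨z, hz, h0⟩ := hαβ i
    rcases h0 with h0 | h0
    · obtain ⟨W', h1, h2, h3, h4⟩ :=
        holdsGenerically_ne_zero hVc.isPreconnected (hα i) ⟨z, hz, h0⟩ W hW hne hWV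
      exact ⟨W', h1, h2, h3, fun z hz => Or.inl (h4 z hz)⟩
    · obtain ⟨W', h1, h2, h3, h4⟩ :=
        holdsGenerically_ne_zero hVc.isPreconnected (hβ i) ⟨z, hz, h0⟩ W hW hne hWV
      exact ⟨W', h1, h2, h3, fun z hz => Or.inr (h4 z hz)⟩
  have g3 : HoldsGenerically V fun z => ∀ ij ∈ (univ : Finset (Fin n × Fin n)).filter
      (fun ij => ij.1 ≠ ij.2), α ij.1 z * β ij.2 z - α ij.2 z * β ij.1 z ≠ 0 := by
    refine holdsGenerically_forall_mem _ fun ij hij => ?_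
    exact holdsGenerically_ne_zero hVc.isPreconnected
      (((hα _).mul (hβ _)).sub ((hα _).mul (hβ _))) (hdet _ _ (mem_filter.1 hij).2)
  have g4 : HoldsGenerically V fun z => ∀ jl ∈ coeffIndex n, AnalyticAt ℂ (b jl.1 jl.2) z := by
    refine holdsGenerically_forall_mem _ fun jl hjl W hW hne hWV => ?_
    exact (hb _ _ (mem_coeffIndex.1 hjl)).holdsGenerically_analyticAt W hW hne (hWV.trans hVM)
  obtain ⟨W, -, ⟨q, hq⟩, hWV, hWq⟩ := ((g1.and g2).and (g3.and g4)) V hV hVc.nonempty subset_rfl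
  obtain ⟨⟨k1, k2⟩, k3, k4⟩ := hWq q hq
  obtain ⟨t, ht⟩ := exists_symbolForm_one_ne_zero (heq q (hWV hq)) k1 fun i => k2 i (mem_univ i)
  refine ⟨t, q, hVM (hWV hq), ?_⟩
  rintro ⟨-, ⟨j, l, hjl, h0⟩ | h0⟩
  · exact h0 (k4 (j, l) (mem_coeffIndex.2 hjl))
  · exact discForm_ne_zero_of_factorization (heq q (hWV hq))
      (fun i j hij => k3 (i, j) (by simpa using hij)) ht h0

theorem constantCoeff_taylorAt (b : ℂ × ℂ → ℂ) (p : ℂ × ℂ) :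
    MvPowerSeries.constantCoeff (taylorAt b p) = b p := by
  rw [← MvPowerSeries.coeff_zero_eq_constantCoeff_apply]
  change taylorAt b p 0 = b p
  simp [taylorAt]

end LPDO

end

theorem mainTheorem6 (M : Set (ℂ × ℂ)) (hM : IsOpen M) (hMc : IsConnected M) (n : ℕ)
    (b : ℕ → ℕ → ℂ × ℂ → ℂ)
    (hb : ∀ j l, j + l ≤ n → LPDO.IsMeromorphicOn (b j l) M)
    (hsep : LPDO.IsSeparable n b M) :
    ∃ Z : Set (ℂ × ℂ), LPDO.IsAnalyticCurveIn Z M ∧ ∀ p ∈ M \ Z,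
      (∀ j l, j + l ≤ n → AnalyticAt ℂ (b j l) p) ∧
      (∃ (c : LPDO.PS) (α β : Fin n → LPDO.PS),
        LPDO.IsSymbolFactorization n (fun j l => LPDO.taylorAt (b j l) p) c α β) ∧
      ∀ (c : LPDO.PS) (α β : Fin n → LPDO.PS),
        LPDO.IsSymbolFactorization n (fun j l => LPDO.taylorAt (b j l) p) c α β →
        (∃ (f : Fin n → LPDO.PS) (h : Fin n → ℕ → LPDO.PS), ∀ i,
          LPDO.IsFDSolution n (fun j l => LPDO.taylorAt (b j l) p) (α i) (β i) (f i) (h i)) ∧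
        ∀ (f : Fin n → LPDO.PS) (h : Fin n → ℕ → LPDO.PS),
          (∀ i, LPDO.IsFDSolution n (fun j l => LPDO.taylorAt (b j l) p)
            (α i) (β i) (f i) (h i)) →
          (⨆ i, LPDO.specialisationSpace (f i) (h i)) =
            LPDO.solutionSpace n (fun j l => LPDO.taylorAt (b j l) p) := by
  obtain ⟨t, hne⟩ := hsep.exists_notMem_singularLocus hb
  have hloc := fun p (hp : p ∈ M) => LPDO.exists_local_equation_singularLocus hM hb t hp
  have hgen := LPDO.not_eventually_mem_of_isPreconnected hMc.isPreconnected (fun p hp => by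
    obtain ⟨U, h1, h2, -, h3, h4⟩ := hloc p hp
    exact ⟨U, h1, h2, h3, h4⟩) hne
  refine ⟨LPDO.singularLocus n b M t, ⟨fun z hz => hz.1, fun p hp => ?_⟩, fun p hp => ?_⟩
  · obtain ⟨U, hU, hpU, hUM, -, φ, hφ, hUZ⟩ := hloc p hp
    refine ⟨U, hU, hpU, hUM, φ, hφ, fun q hq h0 => hgen q (hUM hq) ?_, ?_⟩
    · filter_upwards [h0, hU.mem_nhds hq] with z hz hzU
      exact (hUZ z hzU).2 hz
    · ext z
      exact ⟨fun hz => ⟨hz.2, (hUZ z hz.2).1 hz.1⟩, fun hz => ⟨(hUZ z hz.1).2 hz.2, hz.1⟩⟩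
  · have hnot : ¬ ((∃ j l, j + l ≤ n ∧ ¬ AnalyticAt ℂ (b j l) p) ∨
        LPDO.discForm n t (fun j l => b j l p) = 0) := fun h => hp.2 ⟨hp.1, h⟩
    rw [not_or] at hnot
    refine ⟨fun j l hjl => by_contra fun h => hnot.1 ⟨j, l, hjl, h⟩, ?_, fun c α β hfac =>
      ⟨?_, fun f h hs => hfac.iSup_specialisationSpace_eq hs⟩⟩
    · refine LPDO.exists_isSymbolFactorization (t := t) ?_
      simp only [LPDO.constantCoeff_taylorAt]
      exact hnot.2
    · choose f h hs using hfac.exists_isFDSolution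
      exact ⟨f, h, hs⟩
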